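/- All vector spaces are real. Let $E$ be a Dedekind complete vector lattice. Let $\mathcal L_{\mathrm{ob}}(E)$ be the vector lattice of order bounded linear operators on $E$, ordered by $T\le S$ if and only if $Tx\le Sx$ for all $x\ge 0$, and let $\mathrm{Orth}(E)\subseteq\mathcal L_{\mathrm{ob}}(E)$ be the vector sublattice of orthomorphisms, i.e., of those order bounded operators $T$ with $T(B)\subseteq B$ for every band $B$ of $E$. For $S\subseteq E$, let $B_S$ denote the band in $E$ generated by $S$; an element $e\in E$ is a weak order unit when $B_{\{e\}}=E$. A net $(x_\alpha)$ in a vector lattice is order convergent to $x$ when there is a net $(y_\beta)$ (possibly with a different index set) with $y_\beta\downarrow 0$ such that, for every $\beta_0$, there is an $\alpha_0$ with $|x-x_\alpha|\le y_{\beta_0}$ for all $\alpha\ge\alpha_0$. It is unbounded order convergent to $x$ when $|x_\alpha-x|\wedge y$ is order convergent to $0$ for all $y\ge 0$. A uo-Lebesgue topology on a vector lattice is a linear topology that has a base of solid neighbourhoods of $0$ and in which every net that is unbounded order convergent to $0$ converges to $0$. Suppose that $E$ admits a Hausdorff uo-Lebesgue topology $\widehat\tau_E$. Then $\widehat\tau_E$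 is the only Hausdorff uo-Lebesgue topology on $E$, and $\mathrm{Orth}(E)$ and $\mathcal L_{\mathrm{ob}}(E)$ also admit unique Hausdorff uo-Lebesgue topologies $\widehat\tau_{\mathrm{Orth}(E)}$ and $\widehat\tau_{\mathcal L_{\mathrm{ob}}(E)}$, respectively. Let $(T_\alpha)$ be a net in $\mathrm{Orth}(E)$, and let $S$ be a non-empty subset of $E$ such that $B_S=E$. The following are equivalent: 1. $T_\alpha\to 0$ in $\mathrm{Orth}(E)$ with respect to $\widehat\tau_{\mathrm{Orth}(E)}$; 2. $T_\alpha\to 0$ in $\mathcal L_{\mathrm{ob}}(E)$ with respect to $\widehat\tau_{\mathcal L_{\mathrm{ob}}(E)}$; 3. $T_\alpha s\to 0$ in $E$ with respect to $\widehat\tau_E$ for all $s\in S$; 4. $T_\alpha x\to 0$ in $E$ with respect to $\widehat\tau_E$ for all $x\in E$. In particular, when $E$ has a weak order unit $e$, then $T_\alpha\to 0$ with respect to $\widehat\tau_{\mathrm{Orth}(E)}$ if and only if $T_\alpha e\to 0$ with respect to $\widehat\tau_E$. -/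

import Mathlib

open Set Filter Topology

universe u v

set_option linter.unusedSectionVars false

namespace VL

section General

variable {E : Type u} [AddCommGroup E] [Lattice E]

/-- Order convergence of a net: there is a net `y` (with a possibly different index set) that
decreases to `0` and such that each `y b` eventually dominates `|l - x a|`. -/
def OrderConv {A : Type v} [Preorder A] (x : A → E) (l : E) : Prop :=
  ∃ (B : Type u) (_ : Preorder B) (_ : IsDirectedOrder B) (_ : Nonempty B) (y : B → E),
    Antitone y ∧ IsGLB (range y) 0 ∧ ∀ b₀ : B, ∃ a₀ : A, ∀ a : A, a₀ ≤ a → |l - x a| ≤ y b₀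

/-- Unbounded order convergence of a net. -/
def UOConv {A : Type v} [Preorder A] (x : A → E) (l : E) : Prop :=
  ∀ y : E, 0 ≤ y → OrderConv (fun a => |x a - l| ⊓ y) 0

variable [Module ℝ E]

/-- A band: an ideal (solid linear subspace) that contains the supremum of each of its subsets
whenever that supremum exists in the ambient vector lattice. -/
structure IsBand (B : Submodule ℝ E) : Prop where
  solid : LatticeOrderedAddCommGroup.IsSolid (B : Set E)
  sup_mem : ∀ (A : Set E) (a : E), A ⊆ B → IsLUB A a → a ∈ B

/-- The band `B_S` generated by `S`: the intersection of all bands containing `S`. -/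
def bandSpan (S : Set E) : Submodule ℝ E := sInf {B | IsBand B ∧ S ⊆ B}

/-- `e` is a weak order unit when the band generated by `e` is the whole space. -/
def IsWeakOrderUnit (e : E) : Prop := bandSpan ({e} : Set E) = ⊤

/-- A (not necessarily Hausdorff) locally solid linear topology. -/
structure IsLocallySolid (τ : TopologicalSpace E) : Prop where
  isTopologicalAddGroup : @IsTopologicalAddGroup E τ _
  continuousSMul : @ContinuousSMul ℝ E _ _ τ
  exists_solid : ∀ U ∈ @nhds E τ 0, ∃ V ∈ @nhds E τ 0,
    LatticeOrderedAddCommGroup.IsSolid V ∧ V ⊆ U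

/-- A uo-Lebesgue topology: a locally solid linear topology for which every net that is
unbounded order convergent to `0` converges to `0`. Both kinds of convergence depend only on the
filter of tails of the net, so index sets in the universe of `E` suffice. -/
structure IsUOLebesgue (τ : TopologicalSpace E) : Prop extends IsLocallySolid τ where
  tendsto_of_uoConv : ∀ (A : Type u) [Preorder A] [IsDirectedOrder A] [Nonempty A] (x : A → E),
    UOConv x 0 → Tendsto x atTop (@nhds E τ 0)

/-- A Hausdorff uo-Lebesgue topology. -/
structure IsHausdorffUOLebesgue (τ : TopologicalSpace E) : Prop extends IsUOLebesgue τ where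
  t2Space : @T2Space E τ

end General

/-! ### Order bounded operators -/

section Operators

variable (E : Type u) (F : Type v)
  [AddCommGroup E] [Lattice E] [IsOrderedAddMonoid E] [Module ℝ E]
  [AddCommGroup F] [Lattice F] [IsOrderedAddMonoid F] [Module ℝ F]

/-- The linear space of order bounded operators: linear maps that send order bounded sets to
order bounded sets. -/
def orderBoundedSubmodule [IsOrderedModule ℝ F] : Submodule ℝ (E →ₗ[ℝ] F) where
  carrier := {T | ∀ a b : E, ∃ c d : F, ∀ x ∈ Icc a b, T x ∈ Icc c d}
  zero_mem' := fun _ _ => ⟨0, 0, fun _ _ => by simp⟩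
  add_mem' := by
    intro T S hT hS a b
    obtain ⟨c, d, h⟩ := hT a b
    obtain ⟨c', d', h'⟩ := hS a b
    exact ⟨c + c', d + d', fun x hx =>
      ⟨add_le_add (h x hx).1 (h' x hx).1, add_le_add (h x hx).2 (h' x hx).2⟩⟩
  smul_mem' := by
    intro r T hT a b
    obtain ⟨c, d, h⟩ := hT a b
    rcases le_total 0 r with hr | hr
    · exact ⟨r • c, r • d, fun x hx =>
        ⟨smul_le_smul_of_nonneg_left (h x hx).1 hr, smul_le_smul_of_nonneg_left (h x hx).2 hr⟩⟩
    · exact ⟨r • d, r • c, fun x hx =>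
        ⟨smul_le_smul_of_nonpos_left (h x hx).2 hr, smul_le_smul_of_nonpos_left (h x hx).1 hr⟩⟩

/-- The space `L_ob(E, F)` of order bounded operators from `E` into `F`. -/
def Lob [IsOrderedModule ℝ F] : Type (max u v) := ↥(orderBoundedSubmodule E F)

end Operators

namespace Lob

section Order

variable {E : Type u} {F : Type v}
  [AddCommGroup E] [Lattice E] [IsOrderedAddMonoid E] [Module ℝ E]
  [AddCommGroup F] [Lattice F] [IsOrderedAddMonoid F] [Module ℝ F] [IsOrderedModule ℝ F]

instance : AddCommGroup (Lob E F) := inferInstanceAs (AddCommGroup (orderBoundedSubmodule E F))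

instance : Module ℝ (Lob E F) := inferInstanceAs (Module ℝ (orderBoundedSubmodule E F))

/-- The underlying linear map of an order bounded operator. -/
def toLin (T : Lob E F) : E →ₗ[ℝ] F := T.1

instance : CoeFun (Lob E F) (fun _ => E → F) := ⟨fun T => T.toLin⟩

@[simp] theorem add_apply (T S : Lob E F) (x : E) : (T + S) x = T x + S x := rfl
@[simp] theorem neg_apply (T : Lob E F) (x : E) : (-T) x = -T x := rfl
@[simp] theorem sub_apply (T S : Lob E F) (x : E) : (T - S) x = T x - S x := rfl
@[simp] theorem zero_apply (x : E) : (0 : Lob E F) x = 0 := rfl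
@[simp] theorem smul_apply (r : ℝ) (T : Lob E F) (x : E) : (r • T) x = r • T x := rfl

theorem eq_posPart_sub (x : E) : x = x⁺ - x⁻ := (posPart_sub_negPart x).symm

theorem ext_pos {T S : Lob E F} (h : ∀ x, 0 ≤ x → T x = S x) : T = S := by
  apply Subtype.ext
  apply LinearMap.ext
  intro x
  change T.toLin x = S.toLin x
  rw [eq_posPart_sub x, map_sub, map_sub, h _ (posPart_nonneg x), h _ (negPart_nonneg x)]

/-- The operator order: `T ≤ S` when `T x ≤ S x` for all `x ≥ 0`. -/
instance : PartialOrder (Lob E F) where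
  le T S := ∀ x : E, 0 ≤ x → T x ≤ S x
  le_refl _ _ _ := le_rfl
  le_trans _ _ _ h h' x hx := (h x hx).trans (h' x hx)
  le_antisymm _ _ h h' := ext_pos fun x hx => le_antisymm (h x hx) (h' x hx)

theorem le_def {T S : Lob E F} : T ≤ S ↔ ∀ x : E, 0 ≤ x → T x ≤ S x := Iff.rfl

instance : IsOrderedAddMonoid (Lob E F) where
  add_le_add_left T S h R x hx := by
    simpa using h x hx

instance : IsOrderedModule ℝ (Lob E F) where
  smul_le_smul_of_nonneg_left r hr T S h x hx := by
    simpa using smul_le_smul_of_nonneg_left (h x hx) hr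
  smul_le_smul_of_nonneg_right T hT r s h x hx := by
    simpa using smul_le_smul_of_nonneg_right h (by simpa using hT x hx : 0 ≤ T x)

end Order

section RieszKantorovich

variable {E : Type u} {F : Type v}
  [AddCommGroup E] [Lattice E] [IsOrderedAddMonoid E] [Module ℝ E] [IsOrderedModule ℝ E]
  [AddCommGroup F] [ConditionallyCompleteLattice F] [IsOrderedAddMonoid F] [Module ℝ F]
  [IsOrderedModule ℝ F]

/-- `sup {T y : 0 ≤ y ≤ x}`, the value of `T⁺` at `x ≥ 0`. -/
noncomputable def posVal (T : Lob E F) (x : E) : F := sSup (T '' Icc 0 x)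

theorem isLUB_posVal (T : Lob E F) {x : E} (hx : 0 ≤ x) :
    IsLUB (T '' Icc 0 x) (posVal T x) := by
  obtain ⟨c, d, h⟩ := T.2 0 x
  refine isLUB_csSup ⟨T 0, 0, ⟨le_rfl, hx⟩, rfl⟩ ⟨d, ?_⟩
  rintro _ ⟨y, hy, rfl⟩
  exact (h y hy).2

theorem posVal_add (T : Lob E F) {x y : E} (hx : 0 ≤ x) (hy : 0 ≤ y) :
    posVal T (x + y) = posVal T x + posVal T y := by
  apply le_antisymm
  · apply (isLUB_posVal T (add_nonneg hx hy)).2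
    rintro _ ⟨z, ⟨hz0, hz⟩, rfl⟩
    have h1 : z ⊓ x ∈ Icc 0 x := ⟨le_inf hz0 hx, inf_le_right⟩
    have h2 : z - z ⊓ x ∈ Icc 0 y := by
      refine ⟨sub_nonneg.2 inf_le_left, ?_⟩
      rw [sub_le_iff_le_add, add_inf]
      exact le_inf (le_add_of_nonneg_left hy) (by rwa [add_comm])
    have h3 : T z = T (z ⊓ x) + T (z - z ⊓ x) := by
      rw [← map_add]; congr 1; abel
    rw [h3]
    exact add_le_add ((isLUB_posVal T hx).1 ⟨_, h1, rfl⟩) ((isLUB_posVal T hy).1 ⟨_, h2, rfl⟩)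
  · rw [← le_sub_iff_add_le]
    apply (isLUB_posVal T hx).2
    rintro _ ⟨a, ha, rfl⟩
    rw [le_sub_comm]
    apply (isLUB_posVal T hy).2
    rintro _ ⟨b, hb, rfl⟩
    rw [le_sub_iff_add_le, ← map_add, add_comm b a]
    exact (isLUB_posVal T (add_nonneg hx hy)).1
      ⟨a + b, ⟨add_nonneg ha.1 hb.1, add_le_add ha.2 hb.2⟩, rfl⟩

theorem posVal_smul_le (T : Lob E F) {r : ℝ} (hr : 0 < r) {x : E} (hx : 0 ≤ x) :
    posVal T (r • x) ≤ r • posVal T x := by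
  apply (isLUB_posVal T (smul_nonneg hr.le hx)).2
  rintro _ ⟨z, hz, rfl⟩
  have h1 : r⁻¹ • z ∈ Icc 0 x := by
    refine ⟨smul_nonneg (inv_nonneg.2 hr.le) hz.1, ?_⟩
    have := smul_le_smul_of_nonneg_left hz.2 (inv_nonneg.2 hr.le)
    rwa [smul_smul, inv_mul_cancel₀ hr.ne', one_smul] at this
  have h2 := smul_le_smul_of_nonneg_left ((isLUB_posVal T hx).1 ⟨_, h1, rfl⟩) hr.le
  rwa [map_smul, smul_smul, mul_inv_cancel₀ hr.ne', one_smul] at h2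

theorem posVal_zero (T : Lob E F) : posVal T 0 = 0 := by
  simp [posVal]

theorem posVal_smul (T : Lob E F) {r : ℝ} (hr : 0 ≤ r) {x : E} (hx : 0 ≤ x) :
    posVal T (r • x) = r • posVal T x := by
  rcases hr.eq_or_lt with rfl | hr
  · simp [posVal_zero]
  · refine le_antisymm (posVal_smul_le T hr hx) ?_
    have h := smul_le_smul_of_nonneg_left
      (posVal_smul_le T (inv_pos.2 hr) (smul_nonneg hr.le hx)) hr.le
    rwa [smul_smul, inv_mul_cancel₀ hr.ne', one_smul, smul_smul, mul_inv_cancel₀ hr.ne',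
      one_smul] at h

theorem posVal_nonneg (T : Lob E F) {x : E} (hx : 0 ≤ x) : 0 ≤ posVal T x :=
  (isLUB_posVal T hx).1 ⟨0, ⟨le_rfl, hx⟩, map_zero _⟩

theorem posVal_sub_eq (T : Lob E F) {a b c d : E} (ha : 0 ≤ a) (hb : 0 ≤ b) (hc : 0 ≤ c)
    (hd : 0 ≤ d) (h : a - b = c - d) :
    posVal T a - posVal T b = posVal T c - posVal T d := by
  have h' : a + d = c + b := by
    rw [sub_eq_sub_iff_add_eq_add] at h; exact h
  rw [sub_eq_sub_iff_add_eq_add, ← posVal_add T ha hd, ← posVal_add T hc hb, h']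

/-- The positive part of `T`, as a linear map. -/
noncomputable def posLin (T : Lob E F) : E →ₗ[ℝ] F where
  toFun x := posVal T x⁺ - posVal T x⁻
  map_add' x y := by
    have h := posVal_sub_eq T (posPart_nonneg (x + y)) (negPart_nonneg (x + y))
      (add_nonneg (posPart_nonneg x) (posPart_nonneg y))
      (add_nonneg (negPart_nonneg x) (negPart_nonneg y)) (by
        rw [posPart_sub_negPart, add_sub_add_comm, posPart_sub_negPart, posPart_sub_negPart])
    rw [h, posVal_add T (posPart_nonneg x) (posPart_nonneg y),
      posVal_add T (negPart_nonneg x) (negPart_nonneg y), add_sub_add_comm]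
  map_smul' r x := by
    rw [RingHom.id_apply]
    rcases le_total 0 r with hr | hr
    · have h := posVal_sub_eq T (posPart_nonneg (r • x)) (negPart_nonneg (r • x))
        (smul_nonneg hr (posPart_nonneg x)) (smul_nonneg hr (negPart_nonneg x)) (by
          rw [posPart_sub_negPart, ← smul_sub, posPart_sub_negPart])
      rw [h, posVal_smul T hr (posPart_nonneg x), posVal_smul T hr (negPart_nonneg x), smul_sub]
    · have hr' : 0 ≤ -r := neg_nonneg.2 hr
      have h := posVal_sub_eq T (posPart_nonneg (r • x)) (negPart_nonneg (r • x))
        (smul_nonneg hr' (negPart_nonneg x)) (smul_nonneg hr' (posPart_nonneg x)) (by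
          rw [posPart_sub_negPart, ← smul_sub, neg_smul, ← smul_neg, neg_sub,
            posPart_sub_negPart])
      rw [h, posVal_smul T hr' (posPart_nonneg x), posVal_smul T hr' (negPart_nonneg x),
        ← smul_sub, neg_smul, ← smul_neg, neg_sub]

theorem posLin_apply (T : Lob E F) {x : E} (hx : 0 ≤ x) : posLin T x = posVal T x := by
  change posVal T x⁺ - posVal T x⁻ = posVal T x
  rw [posPart_of_nonneg hx, negPart_of_nonneg hx, posVal_zero, sub_zero]

theorem posLin_mono (T : Lob E F) {x y : E} (h : x ≤ y) : posLin T x ≤ posLin T y := by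
  rw [← sub_nonneg, ← map_sub, posLin_apply T (sub_nonneg.2 h)]
  exact posVal_nonneg T (sub_nonneg.2 h)

/-- The positive part of an order bounded operator. -/
noncomputable def pos (T : Lob E F) : Lob E F :=
  ⟨posLin T, fun a b => ⟨posLin T a, posLin T b, fun _ hx =>
    ⟨posLin_mono T hx.1, posLin_mono T hx.2⟩⟩⟩

theorem isLUB_pos_apply (T : Lob E F) {x : E} (hx : 0 ≤ x) : IsLUB (T '' Icc 0 x) (pos T x) := by
  have h := isLUB_posVal T hx
  rwa [← posLin_apply T hx] at h

theorem isLUB_pos (T : Lob E F) : IsLUB {T, 0} (pos T) := by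
  constructor
  · rintro S (rfl | rfl) x hx
    · exact (isLUB_pos_apply _ hx).1 ⟨x, ⟨hx, le_rfl⟩, rfl⟩
    · exact (isLUB_pos_apply _ hx).1 ⟨0, ⟨le_rfl, hx⟩, map_zero _⟩
  · intro R hR x hx
    have h1 : T ≤ R := hR (by simp)
    have h2 : 0 ≤ R := hR (by simp)
    apply (isLUB_pos_apply T hx).2
    rintro _ ⟨y, hy, rfl⟩
    have h3 : 0 ≤ R (x - y) := h2 _ (sub_nonneg.2 hy.2)
    rw [map_sub, sub_nonneg] at h3
    exact (h1 y hy.1).trans h3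

/-- For a Dedekind complete codomain the order bounded operators form a lattice. -/
noncomputable instance : Lattice (Lob E F) where
  sup T S := pos (T - S) + S
  le_sup_left T S := by
    rw [← sub_le_iff_le_add]
    exact (isLUB_pos _).1 (by simp)
  le_sup_right T S := by
    have h : 0 ≤ pos (T - S) := (isLUB_pos _).1 (by simp)
    exact le_add_of_nonneg_left h
  sup_le T S R h h' := by
    rw [← le_sub_iff_add_le]
    apply (isLUB_pos _).2
    rintro _ (rfl | rfl)
    · exact sub_le_sub_right h _
    · exact sub_nonneg.2 h'
  inf T S := T - pos (T - S)
  inf_le_left T S := by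
    have h : 0 ≤ pos (T - S) := (isLUB_pos _).1 (by simp)
    exact sub_le_self _ h
  inf_le_right T S := by
    rw [sub_le_comm]
    exact (isLUB_pos _).1 (by simp)
  le_inf R T S h h' := by
    rw [le_sub_comm]
    apply (isLUB_pos _).2
    rintro _ (rfl | rfl)
    · exact sub_le_sub_left h' _
    · exact sub_nonneg.2 h

theorem sup_def (T S : Lob E F) : T ⊔ S = pos (T - S) + S := rfl

theorem inf_def (T S : Lob E F) : T ⊓ S = T - pos (T - S) := rfl

end RieszKantorovich

end Lob

/-! ### Orthomorphisms -/

section Orthomorphisms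

variable (E : Type u) [AddCommGroup E] [ConditionallyCompleteLattice E] [IsOrderedAddMonoid E]
  [Module ℝ E] [IsOrderedModule ℝ E]

/-- The orthomorphisms of `E`: the band preserving order bounded operators on `E`. -/
def Orth : Submodule ℝ (Lob E E) where
  carrier := {T | ∀ B : Submodule ℝ E, IsBand B → ∀ x ∈ B, T x ∈ B}
  zero_mem' := fun B _ _ _ => B.zero_mem
  add_mem' := fun hT hS B hB x hx => B.add_mem (hT B hB x hx) (hS B hB x hx)
  smul_mem' := fun r _ hT B hB x hx => B.smul_mem r (hT B hB x hx)

variable {E}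

theorem Orth.pos_mem {T : Lob E E} (hT : T ∈ Orth E) : Lob.pos T ∈ Orth E := by
  intro B hB x hx
  have key : ∀ y ∈ B, 0 ≤ y → Lob.pos T y ∈ B := by
    intro y hy hy0
    refine hB.sup_mem _ _ ?_ (Lob.isLUB_pos_apply T hy0)
    rintro _ ⟨z, hz, rfl⟩
    refine hT B hB z (hB.solid hy ?_)
    rw [abs_of_nonneg hz.1, abs_of_nonneg hy0]
    exact hz.2
  have h1 : x⁺ ∈ B := hB.solid hx (by
    rw [abs_of_nonneg (posPart_nonneg x)]
    exact sup_le (le_abs_self x) (abs_nonneg x))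
  have h2 : x⁻ ∈ B := hB.solid hx (by
    rw [abs_of_nonneg (negPart_nonneg x)]
    exact sup_le (neg_le_abs x) (abs_nonneg x))
  rw [Lob.eq_posPart_sub x, map_sub]
  exact B.sub_mem (key _ h1 (posPart_nonneg x)) (key _ h2 (negPart_nonneg x))

/-- `Orth E` is a vector sublattice of `L_ob(E)`, with the inherited order and operations. -/
noncomputable instance : Lattice (Orth E) :=
  Subtype.lattice
    (fun _ _ hT hS => (Orth E).add_mem (Orth.pos_mem ((Orth E).sub_mem hT hS)) hS)
    (fun _ _ hT hS => (Orth E).sub_mem hT (Orth.pos_mem ((Orth E).sub_mem hT hS)))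

instance : IsOrderedAddMonoid (Orth E) where
  add_le_add_left T S h R := by
    change T.1 + R.1 ≤ S.1 + R.1
    exact add_le_add_left (show T.1 ≤ S.1 from h) R.1

instance : IsOrderedModule ℝ (Orth E) where
  smul_le_smul_of_nonneg_left r hr T S h := by
    change r • T.1 ≤ r • S.1
    exact smul_le_smul_of_nonneg_left (show T.1 ≤ S.1 from h) hr
  smul_le_smul_of_nonneg_right T hT r s h := by
    change r • T.1 ≤ s • T.1
    exact smul_le_smul_of_nonneg_right h (show 0 ≤ T.1 from hT)

end Orthomorphisms

end VL

open VL

/-! ### Disjointness and bands in vector lattices -/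

namespace VL

section RieszSpace

variable {E : Type u} [AddCommGroup E] [Lattice E] [IsOrderedAddMonoid E]

/-! Uniqueness holds on every Dedekind complete lattice. Let `τ` be Hausdorff uo-Lebesgue and `σ`
uo-Lebesgue; then `τ` is finer than `σ`. A normal sequence `V` of solid `τ`-neighbourhoods has a
null part `⋂ n, V n`, and every `y ≥ 0` has a largest element of that null part below it. Since `τ`
is Hausdorff, these elements decrease to `0` as `V` shrinks. A net with one point in each null part
is therefore uo-null, so some null part lies in a given `σ`-neighbourhood
(`NormalSeq.exists_null_subset`). Terms `x n ∈ V n` that are disjoint from the null part also form a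
uo-null sequence (`NormalSeq.uoConv_of_disjoint`). Splitting `|x n|` into these two kinds of pieces
gives `IsHausdorffUOLebesgue.nhds_le`.

Existence comes from pulling `τ` back along the truncated maps `x ↦ φ i (|x| ⊓ s)`, for a separating
directed family of positive order continuous `φ i` (`IsHausdorffUOLebesgue.exists_of_family`). For
operators the `φ i` are evaluations at positive vectors. With the identity on `E`, uniqueness shows
that `τ` only sees truncations `|·| ⊓ s`.

For the equivalences, the lattice operations of orthomorphisms are pointwise on the positive cone
(`Orth.pos_apply`), and `T x` lies in every band containing `x`. To pass from `S` to all of `E`,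
take `g ≥ 0` with `T g → 0`. Then `|T x| ⊓ y ≤ |T g| + p g`, where `p g` is the component of `y` in
the band of `(x - g)⁺`, and `p g` decreases to `0` because `S` generates `E` as a band. -/

theorem add_inf_le {a b c : E} (ha : 0 ≤ a) (hb : 0 ≤ b) (hc : 0 ≤ c) :
    (a + b) ⊓ c ≤ a ⊓ c + b ⊓ c := by
  rw [add_inf, inf_add, inf_add]
  refine le_inf (le_inf inf_le_left ?_) (le_inf ?_ ?_)
  · exact inf_le_right.trans (le_add_of_nonneg_right hb)
  · exact inf_le_right.trans (le_add_of_nonneg_left ha)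
  · exact inf_le_right.trans (le_add_of_nonneg_right hc)

theorem inf_add_le {a b c : E} (ha : 0 ≤ a) (hb : 0 ≤ b) (hc : 0 ≤ c) :
    c ⊓ (a + b) ≤ c ⊓ a + c ⊓ b := by
  simpa only [inf_comm] using add_inf_le ha hb hc

theorem nsmul_inf_le {a c : E} (ha : 0 ≤ a) (hc : 0 ≤ c) (n : ℕ) :
    (n • a) ⊓ c ≤ n • (a ⊓ c) := by
  induction n with
  | zero => simp [hc]
  | succ n ih =>
    rw [succ_nsmul, succ_nsmul]
    exact (add_inf_le (nsmul_nonneg ha n) ha hc).trans (add_le_add_left ih _)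

theorem add_inf_eq_zero {a b c : E} (ha : 0 ≤ a) (hb : 0 ≤ b) (hc : 0 ≤ c)
    (hac : a ⊓ c = 0) (hbc : b ⊓ c = 0) : (a + b) ⊓ c = 0 :=
  le_antisymm ((add_inf_le ha hb hc).trans (by simp [hac, hbc]))
    (le_inf (add_nonneg ha hb) hc)

theorem inf_eq_zero_mono {a b a' b' : E} (ha : 0 ≤ a) (hb : 0 ≤ b) (haa : a ≤ a') (hbb : b ≤ b')
    (h : a' ⊓ b' = 0) : a ⊓ b = 0 :=
  le_antisymm ((inf_le_inf haa hbb).trans h.le) (le_inf ha hb)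

theorem nsmul_inf_eq_zero {a c : E} (ha : 0 ≤ a) (hc : 0 ≤ c) (h : a ⊓ c = 0) (n : ℕ) :
    (n • a) ⊓ c = 0 :=
  le_antisymm ((nsmul_inf_le ha hc n).trans (by simp [h])) (le_inf (nsmul_nonneg ha n) hc)

theorem add_eq_sup_of_inf_eq_zero {a b : E} (h : a ⊓ b = 0) : a + b = a ⊔ b := by
  have := inf_add_sup a b
  rw [h, zero_add] at this
  exact this.symm

/-- The device used throughout to discard the part of an upper bound that is disjoint from `z`. -/
theorem le_of_le_add_of_inf_eq_zero {z p q : E} (hz : 0 ≤ z) (hp : 0 ≤ p) (hq : 0 ≤ q)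
    (h : z ≤ p + q) (hzq : z ⊓ q = 0) : z ≤ p :=
  calc z = z ⊓ (p + q) := (inf_eq_left.2 h).symm
    _ ≤ z ⊓ p + z ⊓ q := inf_add_le hp hq hz
    _ ≤ p := by rw [hzq, add_zero]; exact inf_le_right

theorem posPart_sub_inf_posPart_sub (a b : E) : (a - b)⁺ ⊓ (b - a)⁺ = 0 := by
  have := posPart_inf_negPart_eq_zero (a - b)
  rwa [← posPart_neg, neg_sub] at this

theorem inf_add_posPart_sub (a b : E) : a ⊓ b + (a - b)⁺ = a := by
  rw [inf_eq_sub_posPart_sub, sub_add_cancel]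

theorem posPart_le_abs (a : E) : a⁺ ≤ |a| := sup_le (le_abs_self a) (abs_nonneg a)

theorem negPart_le_abs (a : E) : a⁻ ≤ |a| := sup_le (neg_le_abs a) (abs_nonneg a)

theorem abs_sub_le_add_abs (a b : E) : |a - b| ≤ |a| + |b| := by
  simpa [sub_eq_add_neg] using abs_add_le a (-b)

theorem abs_le_abs_of_nonneg' {a b : E} (ha : 0 ≤ a) (hab : a ≤ b) : |a| ≤ |b| := by
  rwa [abs_of_nonneg ha, abs_of_nonneg (ha.trans hab)]

theorem isLUB_sub_const {A : Set E} {a : E} (h : IsLUB A a) (c : E) :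
    IsGLB ((fun x => c - x) '' A) (c - a) := by
  constructor
  · rintro _ ⟨x, hx, rfl⟩
    exact sub_le_sub_left (h.1 hx) c
  · intro b hb
    rw [le_sub_comm]
    exact h.2 fun x hx => le_sub_comm.1 (hb ⟨x, hx, rfl⟩)

/-- Pairwise disjoint elements below a common bound have their sum below that bound. -/
theorem sum_le_of_pairwise_inf_eq_zero {n : ℕ} {e : ℕ → E} {h : E} (h0 : 0 ≤ h)
    (he : ∀ i < n, 0 ≤ e i) (heh : ∀ i < n, e i ≤ h)
    (hd : ∀ i j, i < j → j < n → e i ⊓ e j = 0) : ∑ i ∈ Finset.range n, e i ≤ h := by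
  induction n with
  | zero => simpa
  | succ n ih =>
    have hs : (∑ i ∈ Finset.range n, e i) ⊓ e n = 0 := by
      have : ∀ m ≤ n, 0 ≤ ∑ i ∈ Finset.range m, e i ∧ (∑ i ∈ Finset.range m, e i) ⊓ e n = 0 := by
        intro m hm
        induction m with
        | zero => simp [he n (Nat.lt_succ_self n)]
        | succ m ihm =>
          obtain ⟨h1, h2⟩ := ihm (by omega)
          rw [Finset.sum_range_succ]
          exact ⟨add_nonneg h1 (he m (by omega)),
            add_inf_eq_zero h1 (he m (by omega)) (he n (by omega)) h2
              (hd m n (by omega) (by omega))⟩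
      exact (this n le_rfl).2
    rw [Finset.sum_range_succ, add_eq_sup_of_inf_eq_zero hs]
    exact sup_le (ih (fun i hi => he i (by omega)) (fun i hi => heh i (by omega))
      (fun i j hij hj => hd i j hij (by omega))) (heh n (by omega))

/-- Disjointness from a fixed element passes to suprema of nonnegative elements. -/
theorem inf_eq_zero_of_isLUB {A : Set E} {a v : E} (hv : 0 ≤ v) (ha : IsLUB A a) (ha0 : 0 ≤ a)
    (h : ∀ x ∈ A, x⁺ ⊓ v = 0) : a ⊓ v = 0 := by
  have h0 : 0 ≤ a ⊓ v := le_inf ha0 hv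
  refine le_antisymm ?_ h0
  -- The right side still bounds `A`: each `x⁺` is disjoint from `a ⊓ v`, so their sum is their
  -- supremum, which is below `a`.
  have : a ≤ a - a ⊓ v := by
    refine ha.2 fun x hx => ?_
    have hxa : x⁺ ≤ a := sup_le (ha.1 hx) ha0
    have hd : x⁺ ⊓ (a ⊓ v) = 0 :=
      inf_eq_zero_mono (posPart_nonneg x) h0 le_rfl inf_le_right (h x hx)
    rw [le_sub_iff_add_le]
    calc x + a ⊓ v ≤ x⁺ + a ⊓ v := add_le_add_left (le_posPart x) _
      _ = x⁺ ⊔ (a ⊓ v) := add_eq_sup_of_inf_eq_zero hd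
      _ ≤ a := sup_le hxa inf_le_left
  rwa [le_sub_self_iff] at this

theorem eq_zero_of_isLUB_empty {a : E} (h : IsLUB (∅ : Set E) a) : a = 0 := by
  have hb : ∀ x, a ≤ x := fun x => h.2 (by simp)
  refine le_antisymm (hb 0) ?_
  have := hb (a + a)
  rwa [le_add_iff_nonneg_right] at this

variable [Module ℝ E] [IsOrderedModule ℝ E]

theorem abs_smul_real (r : ℝ) (x : E) : |r • x| = |r| • |x| := by
  have key : ∀ (s : ℝ) (y : E), |s • y| ≤ |s| • |y| := by
    intro s y
    rcases le_total 0 s with hs | hs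
    · rw [abs_of_nonneg hs]
      refine abs_le'.2 ⟨smul_le_smul_of_nonneg_left (le_abs_self y) hs, ?_⟩
      rw [← smul_neg]
      exact smul_le_smul_of_nonneg_left (neg_le_abs y) hs
    · rw [abs_of_nonpos hs]
      have hs' : 0 ≤ -s := neg_nonneg.2 hs
      refine abs_le'.2 ⟨?_, ?_⟩
      · rw [← neg_smul_neg]
        exact smul_le_smul_of_nonneg_left (neg_le_abs y) hs'
      · rw [← neg_smul]
        exact smul_le_smul_of_nonneg_left (le_abs_self y) hs'
  refine le_antisymm (key r x) ?_
  rcases eq_or_ne r 0 with rfl | hr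
  · simp
  · have h := smul_le_smul_of_nonneg_left (key r⁻¹ (r • x)) (abs_nonneg r)
    rwa [smul_smul, inv_mul_cancel₀ hr, one_smul, smul_smul, ← abs_mul, mul_inv_cancel₀ hr,
      abs_one, one_smul] at h

/-- The disjoint complement of a nonnegative element. -/
def disjointComplement (v : E) (hv : 0 ≤ v) : Submodule ℝ E where
  carrier := {x | |x| ⊓ v = 0}
  zero_mem' := by simp [hv]
  add_mem' := by
    intro a b ha hb
    exact inf_eq_zero_mono (abs_nonneg _) hv (abs_add_le a b) le_rfl
      (add_inf_eq_zero (abs_nonneg a) (abs_nonneg b) hv ha hb)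
  smul_mem' := by
    intro r a ha
    obtain ⟨n, hn⟩ := exists_nat_ge |r|
    refine inf_eq_zero_mono (abs_nonneg _) hv ?_ le_rfl
      (nsmul_inf_eq_zero (abs_nonneg a) hv ha n)
    rw [abs_smul_real, ← Nat.cast_smul_eq_nsmul ℝ]
    exact smul_le_smul_of_nonneg_right hn (abs_nonneg a)

theorem mem_disjointComplement {v : E} {hv : 0 ≤ v} {x : E} :
    x ∈ disjointComplement v hv ↔ |x| ⊓ v = 0 := Iff.rfl

/-- For a supremum `a` of `A`, the part `a⁻` is dominated by `|x₀|` for any single `x₀ ∈ A`, while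
`a⁺` is the supremum of `A` with `0` added. -/
theorem isBand_disjointComplement (v : E) (hv : 0 ≤ v) : IsBand (disjointComplement v hv) where
  solid := fun _ hx _ hyx => inf_eq_zero_mono (abs_nonneg _) hv hyx le_rfl hx
  sup_mem := by
    intro A a hA ha
    -- The definition of a band admits `A = ∅`; a supremum of `∅` is a least element, which must be
    -- `0`.
    rcases A.eq_empty_or_nonempty with rfl | ⟨x₀, hx₀⟩
    · rw [eq_zero_of_isLUB_empty ha]; exact zero_mem _
    have hneg : a⁻ ⊓ v = 0 :=
      inf_eq_zero_mono (negPart_nonneg a) hv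
        ((negPart_anti (ha.1 hx₀)).trans (negPart_le_abs x₀)) le_rfl (hA hx₀)
    have hpos : a⁺ ⊓ v = 0 := by
      have hl : IsLUB (insert 0 A) a⁺ := by
        have := ha.insert 0
        rwa [sup_comm] at this
      refine inf_eq_zero_of_isLUB hv hl (posPart_nonneg a) ?_
      rintro x (rfl | hx)
      · simp [hv]
      · exact inf_eq_zero_mono (posPart_nonneg x) hv (posPart_le_abs x) le_rfl (hA hx)
    rw [mem_disjointComplement, ← posPart_add_negPart]
    exact add_inf_eq_zero (posPart_nonneg a) (negPart_nonneg a) hv hpos hneg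

theorem eq_zero_of_bandSpan_eq_top {S : Set E} (hS : bandSpan S = ⊤) {c : E} (hc : 0 ≤ c)
    (h : ∀ s ∈ S, |s| ⊓ c = 0) : c = 0 := by
  have hle : bandSpan S ≤ disjointComplement c hc :=
    sInf_le ⟨isBand_disjointComplement c hc, fun s hs => h s hs⟩
  rw [hS] at hle
  have : |c| ⊓ c = 0 := hle (Submodule.mem_top : c ∈ ⊤)
  rwa [abs_of_nonneg hc, inf_idem] at this

/-- Dedekind completeness, in a form that keeps the given lattice structure. -/
def DedekindComplete (X : Type*) [Lattice X] : Prop :=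
  ∀ s : Set X, s.Nonempty → BddAbove s → ∃ a, IsLUB s a

/-- The Archimedean property: the supremum `c` of the multiples satisfies `c + a ≤ c`. -/
theorem DedekindComplete.nonpos_of_nsmul_le (hE : DedekindComplete E) {a b : E}
    (h : ∀ n : ℕ, n • a ≤ b) : a ≤ 0 := by
  obtain ⟨c, hc⟩ := hE (range fun n : ℕ => n • a) (range_nonempty _)
    ⟨b, by rintro _ ⟨n, rfl⟩; exact h n⟩
  have : c ≤ c - a := by
    refine hc.2 ?_
    rintro _ ⟨n, rfl⟩
    rw [le_sub_iff_add_le]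
    have := hc.1 ⟨n + 1, rfl⟩
    simpa [succ_nsmul] using this
  rwa [le_sub_self_iff] at this

theorem DedekindComplete.le_of_forall_smul_le (hE : DedekindComplete E) {a b h : E}
    (H : ∀ n : ℕ, 0 < n → a ≤ b + (n : ℝ)⁻¹ • h) : a ≤ b := by
  rw [← sub_nonpos]
  refine hE.nonpos_of_nsmul_le (b := h ⊔ 0) fun n => ?_
  rcases Nat.eq_zero_or_pos n with rfl | hn
  · simp
  have hn' : (0 : ℝ) < n := by exact_mod_cast hn
  have h1 := smul_le_smul_of_nonneg_left (sub_le_iff_le_add'.2 (H n hn)) hn'.le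
  rw [smul_smul, mul_inv_cancel₀ hn'.ne', one_smul, Nat.cast_smul_eq_nsmul] at h1
  exact h1.trans le_sup_left

theorem DedekindComplete.exists_isLUB_inf_nsmul (hE : DedekindComplete E) (y b : E) :
    ∃ p, IsLUB (range fun n : ℕ => y ⊓ n • b) p :=
  hE _ (range_nonempty _) ⟨y, by rintro _ ⟨n, rfl⟩; exact inf_le_left⟩

/-- The component of `y` in the band generated by `b`, given as `sup_n (y ⊓ n b)`, dominates
every element below `y` of that band. -/
theorem le_of_isLUB_inf_nsmul {y b p z : E} (hb : 0 ≤ b) (hz : 0 ≤ z)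
    (hp : IsLUB (range fun n : ℕ => y ⊓ n • b) p) (hzy : z ≤ y)
    (hzb : ∀ v, 0 ≤ v → b ⊓ v = 0 → z ⊓ v = 0) : z ≤ p := by
  have hy : 0 ≤ y := hz.trans hzy
  have hp0 : 0 ≤ p := by
    have := hp.1 ⟨0, rfl⟩
    simpa [hy] using this
  have hpy : p ≤ y := hp.2 (by rintro _ ⟨n, rfl⟩; exact inf_le_left)
  have hq : 0 ≤ y - p := sub_nonneg.2 hpy
  have hd : b ⊓ (y - p) = 0 := by
    refine le_antisymm ?_ (le_inf hb hq)
    -- Adding `b ⊓ (y - p)` to `y ⊓ n • b` stays below `y ⊓ (n + 1) • b`, hence below `p`.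
    have : p ≤ p - b ⊓ (y - p) := by
      refine hp.2 ?_
      rintro _ ⟨n, rfl⟩
      rw [le_sub_iff_add_le]
      have hn : y ⊓ n • b ≤ p := hp.1 ⟨n, rfl⟩
      refine le_trans (le_inf ?_ ?_) (hp.1 ⟨n + 1, rfl⟩)
      · calc y ⊓ n • b + b ⊓ (y - p) ≤ p + (y - p) := add_le_add hn inf_le_right
          _ = y := by abel
      · rw [succ_nsmul]
        exact add_le_add inf_le_right inf_le_left
    rwa [le_sub_self_iff] at this
  exact le_of_le_add_of_inf_eq_zero hz hp0 hq (by simpa using hzy) (hzb _ hq hd)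

end RieszSpace

end VL

/-! ### Locally solid and uo-Lebesgue topologies -/

namespace VL

section LocallySolid

variable {E : Type u} [AddCommGroup E] [Lattice E] [IsOrderedAddMonoid E] [Module ℝ E]
  [IsOrderedModule ℝ E] {τ : TopologicalSpace E}

open LatticeOrderedAddCommGroup

theorem IsLocallySolid.exists_solid_add (hτ : IsLocallySolid τ) {U : Set E}
    (hU : U ∈ @nhds E τ 0) :
    ∃ V ∈ @nhds E τ 0, IsSolid V ∧ V ⊆ U ∧ ∀ a ∈ V, ∀ b ∈ V, a + b ∈ U := by
  have := hτ.isTopologicalAddGroup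
  obtain ⟨W, hW, hWU⟩ := exists_nhds_zero_half hU
  obtain ⟨V, hV, hVs, hVW⟩ := hτ.exists_solid W hW
  have hV0 : (0 : E) ∈ V := mem_of_mem_nhds hV
  refine ⟨V, hV, hVs, fun a ha => ?_, fun a ha b hb => hWU a (hVW ha) b (hVW hb)⟩
  simpa using hWU a (hVW ha) 0 (hVW hV0)

theorem IsLocallySolid.tendsto_of_abs_le (hτ : IsLocallySolid τ) {α : Type*} {l : Filter α}
    {f g : α → E} (hg : Tendsto g l (@nhds E τ 0)) (h : ∀ᶠ a in l, |f a| ≤ |g a|) :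
    Tendsto f l (@nhds E τ 0) := by
  intro U hU
  obtain ⟨V, hV, hVs, hVU⟩ := hτ.exists_solid U hU
  exact (hg.eventually hV).mp (h.mono fun a hfa ha => hVU (hVs ha hfa))

theorem IsLocallySolid.tendsto_of_nonneg_of_le (hτ : IsLocallySolid τ) {α : Type*} {l : Filter α}
    {f g : α → E} (hg : Tendsto g l (@nhds E τ 0)) (h0 : ∀ a, 0 ≤ f a) (h : ∀ a, f a ≤ g a) :
    Tendsto f l (@nhds E τ 0) :=
  hτ.tendsto_of_abs_le hg (Eventually.of_forall fun a => abs_le_abs_of_nonneg' (h0 a) (h a))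

theorem IsLocallySolid.tendsto_abs_iff (hτ : IsLocallySolid τ) {α : Type*} {l : Filter α}
    {f : α → E} : Tendsto (fun a => |f a|) l (@nhds E τ 0) ↔ Tendsto f l (@nhds E τ 0) :=
  ⟨fun h => hτ.tendsto_of_abs_le h (by simp), fun h => hτ.tendsto_of_abs_le h (by simp)⟩

theorem IsLocallySolid.tendsto_add (hτ : IsLocallySolid τ) {α : Type*} {l : Filter α}
    {f g : α → E} (hf : Tendsto f l (@nhds E τ 0)) (hg : Tendsto g l (@nhds E τ 0)) :
    Tendsto (fun a => f a + g a) l (@nhds E τ 0) := by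
  have := hτ.isTopologicalAddGroup
  simpa using hf.add hg

theorem OrderConv.of_abs_le {A : Type v} [Preorder A] {x : A → E} {B : Type u} [Preorder B]
    [IsDirectedOrder B] [Nonempty B] (y : B → E) (hy : Antitone y) (h0 : IsGLB (range y) 0)
    (h : ∀ b, ∃ a₀, ∀ a, a₀ ≤ a → |x a| ≤ y b) : OrderConv x 0 :=
  ⟨B, inferInstance, inferInstance, inferInstance, y, hy, h0, by simpa using h⟩

theorem UOConv.of_inf_le {A : Type v} [Preorder A] {x : A → E}
    (h : ∀ y : E, 0 ≤ y → ∃ (B : Type u) (_ : Preorder B) (_ : IsDirectedOrder B) (_ : Nonempty B)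
      (z : B → E), Antitone z ∧ IsGLB (range z) 0 ∧
        ∀ b, ∃ a₀, ∀ a, a₀ ≤ a → |x a| ⊓ y ≤ z b) : UOConv x 0 := by
  intro y hy
  obtain ⟨B, _, _, _, z, hz, hz0, hB⟩ := h y hy
  refine OrderConv.of_abs_le z hz hz0 fun b => ?_
  obtain ⟨a₀, ha₀⟩ := hB b
  refine ⟨a₀, fun a ha => ?_⟩
  rw [sub_zero, abs_of_nonneg (le_inf (abs_nonneg _) hy)]
  exact ha₀ a ha

/-- Nets decreasing to `0` are topologically null for a uo-Lebesgue topology. -/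
theorem IsUOLebesgue.tendsto_of_antitone (hτ : IsUOLebesgue τ) {B : Type u} [Preorder B]
    [IsDirectedOrder B] [Nonempty B] {y : B → E} (hy : Antitone y) (h0 : IsGLB (range y) 0) :
    Tendsto y atTop (@nhds E τ 0) := by
  refine hτ.tendsto_of_uoConv B y (UOConv.of_inf_le fun u _ =>
    ⟨B, inferInstance, inferInstance, inferInstance, y, hy, h0, fun b => ⟨b, fun a ha => ?_⟩⟩)
  rw [abs_of_nonneg (h0.1 ⟨a, rfl⟩)]
  exact inf_le_left.trans (hy ha)

/-- An upward directed set with supremum `a` contains elements approximating `a`. -/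
theorem IsUOLebesgue.exists_sub_mem (hτ : IsUOLebesgue τ) {D : Set E} {a : E} (ha : IsLUB D a)
    (hne : D.Nonempty) (hD : DirectedOn (· ≤ ·) D) {U : Set E} (hU : U ∈ @nhds E τ 0) :
    ∃ x ∈ D, a - x ∈ U := by
  have : Nonempty D := hne.to_subtype
  have : IsDirectedOrder D := directedOn_iff_isDirectedOrder.1 hD
  have hg : IsGLB (range fun x : D => a - (x : E)) 0 := by
    have := isLUB_sub_const ha a
    rwa [sub_self, image_eq_range] at this
  have ht := hτ.tendsto_of_antitone (y := fun x : D => a - (x : E))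
    (fun x y hxy => sub_le_sub_left (show (x : E) ≤ y from hxy) a) hg
  obtain ⟨x, hx⟩ := (ht.eventually hU).exists
  exact ⟨x, x.2, hx⟩

/-! ### Normal sequences and uniqueness -/

variable (τ) in
/-- A normal sequence of solid neighbourhoods of `0`. -/
structure NormalSeq where
  toSet : ℕ → Set E
  mem_nhds : ∀ n, toSet n ∈ @nhds E τ 0
  solid : ∀ n, IsSolid (toSet n)
  add_mem : ∀ n, ∀ a ∈ toSet (n + 1), ∀ b ∈ toSet (n + 1), a + b ∈ toSet n

namespace NormalSeq

/-- Reverse inclusion, so that nets indexed by normal sequences run through ever smaller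
neighbourhoods. -/
instance : Preorder (NormalSeq τ) where
  le V W := ∀ n, W.toSet n ⊆ V.toSet n
  le_refl _ _ := Subset.rfl
  le_trans _ _ _ h h' n := (h' n).trans (h n)

instance : IsDirectedOrder (NormalSeq τ) where
  directed V W :=
    ⟨{ toSet := fun n => V.toSet n ∩ W.toSet n
       mem_nhds := fun n => inter_mem (V.mem_nhds n) (W.mem_nhds n)
       solid := fun n _ hx _ hy => ⟨V.solid n hx.1 hy, W.solid n hx.2 hy⟩
       add_mem := fun n a ha b hb =>
        ⟨V.add_mem n a ha.1 b hb.1, W.add_mem n a ha.2 b hb.2⟩ },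
      fun _ => inter_subset_left, fun _ => inter_subset_right⟩

theorem exists_subset (hτ : IsLocallySolid τ) {U : Set E} (hU : U ∈ @nhds E τ 0) :
    ∃ V : NormalSeq τ, V.toSet 0 ⊆ U := by
  choose! f hf hfs _ hfa using fun (U : Set E) (hU : U ∈ @nhds E τ 0) => hτ.exists_solid_add hU
  obtain ⟨V, hV, hVs, hVU⟩ := hτ.exists_solid U hU
  have key : ∀ n, f^[n] V ∈ @nhds E τ 0 ∧ IsSolid (f^[n] V) := by
    intro n
    induction n with
    | zero => exact ⟨hV, hVs⟩
    | succ n ih =>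
      rw [Function.iterate_succ_apply']
      exact ⟨hf _ ih.1, hfs _ ih.1⟩
  refine ⟨⟨fun n => f^[n] V, fun n => (key n).1, fun n => (key n).2, fun n a ha b hb => ?_⟩, hVU⟩
  simp only [Function.iterate_succ_apply'] at ha hb
  exact hfa _ (key n).1 a ha b hb

theorem exists_notMem (hτ : IsHausdorffUOLebesgue τ) {x : E} (hx : x ≠ 0) :
    ∃ V : NormalSeq τ, x ∉ V.toSet 0 := by
  have := hτ.t2Space
  obtain ⟨V, hV⟩ := exists_subset hτ.toIsLocallySolid
    (isOpen_compl_singleton.mem_nhds (Ne.symm hx) : {x}ᶜ ∈ @nhds E τ 0)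
  exact ⟨V, fun h => hV h rfl⟩

theorem nonempty (hτ : IsLocallySolid τ) : Nonempty (NormalSeq τ) :=
  ⟨(exists_subset hτ univ_mem).choose⟩

variable (V : NormalSeq τ)

theorem zero_mem (n : ℕ) : (0 : E) ∈ V.toSet n := mem_of_mem_nhds (V.mem_nhds n)

/-- The common null part of a normal sequence. -/
def null : Set E := ⋂ n, V.toSet n

theorem mem_null {x : E} : x ∈ V.null ↔ ∀ n, x ∈ V.toSet n := mem_iInter

theorem null_solid : IsSolid V.null := fun _ hx _ hy =>
  V.mem_null.2 fun n => V.solid n (V.mem_null.1 hx n) hy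

theorem null_add {a b : E} (ha : a ∈ V.null) (hb : b ∈ V.null) : a + b ∈ V.null :=
  V.mem_null.2 fun n => V.add_mem n a (V.mem_null.1 ha _) b (V.mem_null.1 hb _)

theorem null_of_le {a b : E} (ha : 0 ≤ a) (hab : a ≤ b) (hb : b ∈ V.null) : a ∈ V.null :=
  V.null_solid hb (abs_le_abs_of_nonneg' ha hab)

theorem null_anti {V W : NormalSeq τ} (h : V ≤ W) : W.null ⊆ V.null := fun _ hx =>
  V.mem_null.2 fun n => h n (W.mem_null.1 hx n)

/-- Some `x ∈ D` has `a - x` in `V (n + 1)`, because decreasing null nets are topologically null;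
one index is lost in adding `x` back. -/
theorem mem_of_isLUB (hτ : IsUOLebesgue τ) {D : Set E} {a : E} (ha : IsLUB D a)
    (hne : D.Nonempty) (hD : DirectedOn (· ≤ ·) D) {n : ℕ} (h : D ⊆ V.toSet (n + 1)) :
    a ∈ V.toSet n := by
  obtain ⟨x, hx, hax⟩ := hτ.exists_sub_mem ha hne hD (V.mem_nhds (n + 1))
  simpa using V.add_mem n _ hax x (h hx)

/-- The component of `y` in the null part. -/
theorem exists_isLUB_null (hE : DedekindComplete E) (hτ : IsUOLebesgue τ) {y : E} (hy : 0 ≤ y) :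
    ∃ p, IsLUB (V.null ∩ Icc 0 y) p ∧ p ∈ V.null ∧ 0 ≤ p ∧ p ≤ y := by
  have h0 : (0 : E) ∈ V.null ∩ Icc 0 y := ⟨V.mem_null.2 V.zero_mem, le_rfl, hy⟩
  obtain ⟨p, hp⟩ := hE (V.null ∩ Icc 0 y) ⟨0, h0⟩ ⟨y, fun x hx => hx.2.2⟩
  refine ⟨p, hp, ?_, hp.1 h0, hp.2 fun x hx => hx.2.2⟩
  refine V.mem_null.2 fun n => V.mem_of_isLUB hτ hp ⟨0, h0⟩ ?_
    fun x hx => V.mem_null.1 hx.1 (n + 1)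
  intro a ha b hb
  have hab : 0 ≤ a ⊔ b := ha.2.1.trans le_sup_left
  refine ⟨a ⊔ b, ⟨V.null_of_le hab ?_ (V.null_add ha.1 hb.1), hab, sup_le ha.2.2 hb.2.2⟩,
    le_sup_left, le_sup_right⟩
  exact sup_le (le_add_of_nonneg_right hb.2.1) (le_add_of_nonneg_left ha.2.1)

/-- Peel off the first term: `x (n + 1)` and the remaining sum both lie in `V (n + 1)`, whatever the
number of terms. -/
theorem sum_mem {x : ℕ → E} (hx : ∀ n, x n ∈ V.toSet n) (k n : ℕ) :
    ∑ i ∈ Finset.range k, x (n + 1 + i) ∈ V.toSet n := by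
  induction k generalizing n with
  | zero => simpa using V.zero_mem n
  | succ k ih =>
    rw [Finset.sum_range_succ']
    refine V.add_mem n _ ?_ _ (hx (n + 1))
    have := ih (n + 1)
    simpa only [add_assoc, add_comm, add_left_comm] using this

/-- A sequence with `x n ∈ V n` whose terms are disjoint from the null part of `V` is unbounded
order null. -/
theorem uoConv_of_disjoint (hE : DedekindComplete E) (hτ : IsUOLebesgue τ) {x : ℕ → E}
    (hx0 : ∀ n, 0 ≤ x n) (hx : ∀ n, x n ∈ V.toSet n)
    (hd : ∀ n, ∀ v ∈ V.null, 0 ≤ v → x n ⊓ v = 0) :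
    UOConv (fun n : ULift.{u} ℕ => x n.down) 0 := by
  refine UOConv.of_inf_le fun y hy => ?_
  have hb : ∀ n, BddAbove (range fun i => x (n + i) ⊓ y) := fun n =>
    ⟨y, by rintro _ ⟨i, rfl⟩; exact inf_le_right⟩
  -- The truncated tail suprema `s n` will be the dominating sequence; it remains to show that they
  -- decrease to `0`.
  choose s hs using fun n => hE _ (range_nonempty fun i => x (n + i) ⊓ y) (hb n)
  have hs0 : ∀ n, 0 ≤ s n := fun n => (le_inf (hx0 _) hy).trans ((hs n).1 ⟨0, rfl⟩)
  have hanti : Antitone s := by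
    intro m n hmn
    refine (hs n).2 ?_
    rintro _ ⟨i, rfl⟩
    refine (hs m).1 ⟨n - m + i, ?_⟩
    simp only
    congr 2
    omega
  -- Finite suprema are bounded by finite sums, which lie in `V (n + 1)`; passing to the full
  -- supremum costs the second index.
  have hmem : ∀ n, s (n + 2) ∈ V.toSet n := by
    intro n
    have hL : IsLUB (range (partialSups fun i => x (n + 2 + i) ⊓ y)) (s (n + 2)) := by
      have := hs (n + 2)
      rw [IsLUB, ← upperBounds_range_partialSups] at this
      exact this
    refine V.mem_of_isLUB hτ hL (range_nonempty _)
      (directedOn_range.2 (partialSups _).monotone.directed_le) ?_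
    rintro _ ⟨k, rfl⟩
    have h0 : ∀ j, 0 ≤ x (n + 2 + j) ⊓ y := fun j => le_inf (hx0 _) hy
    refine V.solid (n + 1) (V.sum_mem hx (k + 1) (n + 1)) (abs_le_abs_of_nonneg' ?_ ?_)
    · exact (h0 0).trans (le_partialSups_of_le (fun i => x (n + 2 + i) ⊓ y) (Nat.zero_le k))
    · refine partialSups_le _ _ _ fun i hi => inf_le_left.trans ?_
      exact Finset.single_le_sum (f := fun i => x (n + 1 + 1 + i)) (fun j _ => hx0 _)
        (Finset.mem_range.2 (Nat.lt_succ_of_le hi))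
  -- A lower bound `z` has `z⁺` in the null part by `hmem`, yet `s 0` is a supremum of elements
  -- disjoint from the null part. So `z⁺` is disjoint from `s 0` while lying below it.
  have hglb : IsGLB (range s) 0 := by
    refine ⟨by rintro _ ⟨n, rfl⟩; exact hs0 n, fun z hz => ?_⟩
    have hzs : ∀ n, z⁺ ≤ s n := fun n => sup_le (hz ⟨n, rfl⟩) (hs0 n)
    have hzN : z⁺ ∈ V.null := V.mem_null.2 fun n =>
      V.solid n (hmem n) (abs_le_abs_of_nonneg' (posPart_nonneg z) (hzs _))
    have hdis : s 0 ⊓ z⁺ = 0 := by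
      refine inf_eq_zero_of_isLUB (posPart_nonneg z) (hs 0) (hs0 0) ?_
      rintro _ ⟨i, rfl⟩
      rw [posPart_of_nonneg (le_inf (hx0 _) hy)]
      exact inf_eq_zero_mono (le_inf (hx0 _) hy) (posPart_nonneg z) inf_le_left le_rfl
        (hd _ _ hzN (posPart_nonneg z))
    rw [inf_eq_right.2 (hzs 0)] at hdis
    exact posPart_eq_zero.1 hdis
  -- The lift places the index set in the universe of `E`, where order convergence takes its
  -- dominating nets.
  refine ⟨ULift.{u} ℕ, inferInstance, inferInstance, inferInstance, fun n => s n.down,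
    fun m n h => hanti h, ?_, fun n => ⟨n, fun m hm => ?_⟩⟩
  · have : range (fun n : ULift.{u} ℕ => s n.down) = range s :=
      (ULift.down_surjective).range_comp s
    rwa [this]
  · rw [abs_of_nonneg (hx0 _)]
    have hm' : n.down ≤ m.down := hm
    refine (hs n.down).1 ⟨m.down - n.down, ?_⟩
    simp only
    rw [Nat.add_sub_cancel' hm']

/-- The null parts of the normal sequences of a Hausdorff uo-Lebesgue topology become arbitrarily
small for every uo-Lebesgue topology. -/
theorem exists_null_subset (hE : DedekindComplete E) (hτ : IsHausdorffUOLebesgue τ)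
    {σ : TopologicalSpace E} (hσ : IsUOLebesgue σ) {U : Set E} (hU : U ∈ @nhds E σ 0) :
    ∃ V : NormalSeq τ, V.null ⊆ U := by
  have hτu := hτ.toIsUOLebesgue
  by_contra hcon
  simp only [not_exists, not_subset] at hcon
  -- The counterexamples form a net indexed by the normal sequences themselves, dominated after
  -- truncation at `y` by the null components `p V` of `y`.
  choose x hxN hxU using hcon
  have := nonempty hτ.toIsLocallySolid
  have huo : UOConv x 0 := by
    refine UOConv.of_inf_le fun y hy => ?_
    choose p hp hpN hp0 hpy using fun V : NormalSeq τ => V.exists_isLUB_null hE hτu hy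
    refine ⟨NormalSeq τ, inferInstance, inferInstance, inferInstance, p, ?_, ?_, ?_⟩
    · intro V W h
      exact (hp W).2 fun z hz => (hp V).1 ⟨null_anti h hz.1, hz.2⟩
    · refine ⟨by rintro _ ⟨V, rfl⟩; exact hp0 V, fun q hq => ?_⟩
      rw [← posPart_eq_zero]
      by_contra hne
      obtain ⟨V, hV⟩ := exists_notMem hτ hne
      have : q⁺ ∈ V.null := V.null_of_le (posPart_nonneg q)
        (sup_le (hq ⟨V, rfl⟩) (hp0 V)) (hpN V)
      exact hV (V.mem_null.1 this 0)
    · intro V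
      refine ⟨V, fun W hW => (hp V).1 ⟨?_, le_inf (abs_nonneg _) hy, inf_le_right⟩⟩
      have h1 : |x W| ∈ V.null := V.null_solid (null_anti hW (hxN W)) (by simp)
      exact V.null_of_le (le_inf (abs_nonneg _) hy) inf_le_left h1
  obtain ⟨V, hV⟩ := ((hσ.tendsto_of_uoConv _ x huo).eventually hU).exists
  exact hxU V hV

end NormalSeq

/-- If no `V n` fits into the `σ`-neighbourhood, split `|x n|` for escaping points `x n ∈ V n` as
`(|x n| - p n) + p n`, with `p n` the null component. The first piece is `σ`-null, being uo-null,
and the second is `σ`-small by the choice of `V`. -/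
theorem IsHausdorffUOLebesgue.nhds_le (hE : DedekindComplete E) (hτ : IsHausdorffUOLebesgue τ)
    {σ : TopologicalSpace E} (hσ : IsUOLebesgue σ) : @nhds E τ 0 ≤ @nhds E σ 0 := by
  intro U hU
  have hτu := hτ.toIsUOLebesgue
  obtain ⟨U₂, hU₂, hU₂s, hU₂U⟩ := hσ.exists_solid U hU
  obtain ⟨U₁, hU₁, -, -, hU₁a⟩ := hσ.exists_solid_add hU₂
  obtain ⟨V, hV⟩ := NormalSeq.exists_null_subset hE hτ hσ hU₁
  by_contra hcon
  have hn : ∀ n, ∃ x ∈ V.toSet n, x ∉ U₂ := fun n => by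
    by_contra hc
    push Not at hc
    exact hcon (mem_of_superset (V.mem_nhds n) fun x hx => hU₂U (hc x hx))
  choose x hxV hxU using hn
  choose p hp hpN hp0 hpx using fun n => V.exists_isLUB_null hE hτu (abs_nonneg (x n))
  have huo := V.uoConv_of_disjoint hE hτu (x := fun n => |x n| - p n)
    (fun n => sub_nonneg.2 (hpx n))
    (fun n => V.solid n (hxV n) (by
      rw [abs_of_nonneg (sub_nonneg.2 (hpx n))]
      exact sub_le_self _ (hp0 n)))
    (fun n v hv hv0 => by
      have h0 : 0 ≤ (|x n| - p n) ⊓ v := le_inf (sub_nonneg.2 (hpx n)) hv0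
      refine le_antisymm ?_ h0
      -- The left side is a null element below `|x n|`, and `p n` is the largest such.
      have : p n + (|x n| - p n) ⊓ v ≤ p n := by
        refine (hp n).1 ⟨V.null_add (hpN n) (V.null_of_le h0 inf_le_right hv),
          add_nonneg (hp0 n) h0, ?_⟩
        rw [← le_sub_iff_add_le']
        exact inf_le_left
      rwa [add_le_iff_nonpos_right] at this)
  obtain ⟨n, hn⟩ := ((hσ.tendsto_of_uoConv _ _ huo).eventually hU₁).exists
  have := hU₁a _ hn _ (hV (hpN n.down))
  rw [sub_add_cancel] at this
  exact hxU n.down (hU₂s this (by simp))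

theorem IsHausdorffUOLebesgue.unique (hE : DedekindComplete E) {σ : TopologicalSpace E}
    (hτ : IsHausdorffUOLebesgue τ) (hσ : IsHausdorffUOLebesgue σ) : τ = σ :=
  IsTopologicalAddGroup.ext hτ.isTopologicalAddGroup hσ.isTopologicalAddGroup
    (le_antisymm (hτ.nhds_le hE hσ.toIsUOLebesgue) (hσ.nhds_le hE hτ.toIsUOLebesgue))

end LocallySolid

end VL

/-! ### Construction of uo-Lebesgue topologies -/

namespace VL

section Existence

variable {E : Type u} [AddCommGroup E] [Lattice E] [IsOrderedAddMonoid E] [Module ℝ E]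
  [IsOrderedModule ℝ E] {τ : TopologicalSpace E}
  {X : Type u} [AddCommGroup X] [Lattice X] [IsOrderedAddMonoid X] [Module ℝ X]
  [IsOrderedModule ℝ X]

open LatticeOrderedAddCommGroup Pointwise

/-- A directed family of vector-valued Riesz pseudonorms induces a locally solid topology. -/
theorem IsLocallySolid.exists_of_pseudonorms (hτ : IsLocallySolid τ) {J : Type*} [Nonempty J]
    (ρ : J → X → E) (hzero : ∀ j, ρ j 0 = 0) (hmono : ∀ j a b, |a| ≤ |b| → ρ j a ≤ ρ j b)
    (hadd : ∀ j a b, ρ j (a + b) ≤ ρ j a + ρ j b)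
    (hsmul : ∀ j x, ∃ e, ∀ r : ℝ, ρ j (r • x) ≤ |r| • e)
    (hdir : ∀ j k, ∃ l, (∀ x, ρ j x ≤ ρ l x) ∧ ∀ x, ρ k x ≤ ρ l x) :
    ∃ σ : TopologicalSpace X, IsLocallySolid σ ∧
      @nhds X σ 0 = ⨅ j, comap (ρ j) (@nhds E τ 0) := by
  have hnn : ∀ j x, 0 ≤ ρ j x := fun j x => by
    rw [← hzero j]; exact hmono j 0 x (by simp)
  have hsol : ∀ {U : Set E}, IsSolid U → ∀ {j k x y}, ρ k y ∈ U → ρ j x ≤ ρ k y → ρ j x ∈ U :=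
    fun hU _ _ _ _ h hle => hU h (abs_le_abs_of_nonneg' (hnn _ _) hle)
  have hn : ∀ j x (n : ℕ), ρ j (n • x) ≤ n • ρ j x := fun j x n => by
    induction n with
    | zero => simp [hzero]
    | succ n ih =>
      rw [succ_nsmul, succ_nsmul]
      exact (hadd j _ _).trans (add_le_add_left ih _)
  have := hτ.isTopologicalAddGroup
  have := hτ.continuousSMul
  let B : ModuleFilterBasis ℝ X :=
    { sets := {s | ∃ j, ∃ U ∈ @nhds E τ 0, IsSolid U ∧ s = {x | ρ j x ∈ U}}
      nonempty := by
        obtain ⟨j⟩ := ‹Nonempty J›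
        exact ⟨_, j, univ, univ_mem, fun _ _ _ _ => mem_univ _, rfl⟩
      inter_sets := by
        rintro _ _ ⟨j, U, hU, hUs, rfl⟩ ⟨k, W, hW, hWs, rfl⟩
        obtain ⟨l, hj, hk⟩ := hdir j k
        refine ⟨_, ⟨l, U ∩ W, inter_mem hU hW,
          fun _ hx _ hy => ⟨hUs hx.1 hy, hWs hx.2 hy⟩, rfl⟩, fun x hx => ⟨?_, ?_⟩⟩
        · exact hsol hUs hx.1 (hj x)
        · exact hsol hWs hx.2 (hk x)
      zero' := by
        rintro _ ⟨j, U, hU, hUs, rfl⟩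
        simpa [hzero] using mem_of_mem_nhds hU
      add' := by
        rintro _ ⟨j, U, hU, hUs, rfl⟩
        obtain ⟨V, hV, hVs, -, hVa⟩ := hτ.exists_solid_add hU
        refine ⟨_, ⟨j, V, hV, hVs, rfl⟩, ?_⟩
        rintro _ ⟨a, ha, b, hb, rfl⟩
        exact hUs (hVa _ ha _ hb) (abs_le_abs_of_nonneg' (hnn _ _) (hadd j a b))
      neg' := by
        rintro _ ⟨j, U, hU, hUs, rfl⟩
        exact ⟨_, ⟨j, U, hU, hUs, rfl⟩, fun x hx => hsol hUs hx (hmono j _ _ (by simp))⟩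
      conj' := by
        rintro x _ ⟨j, U, hU, hUs, rfl⟩
        exact ⟨_, ⟨j, U, hU, hUs, rfl⟩, fun y hy => by simpa using hy⟩
      smul' := by
        rintro _ ⟨j, U, hU, hUs, rfl⟩
        refine ⟨Metric.ball 0 1, Metric.ball_mem_nhds 0 one_pos, _, ⟨j, U, hU, hUs, rfl⟩, ?_⟩
        rintro _ ⟨r, hr, x, hx, rfl⟩
        refine hsol hUs hx (hmono j _ _ ?_)
        have hr' : |r| ≤ 1 := by
          have : |r| < 1 := by simpa using hr
          exact this.le
        have := smul_le_smul_of_nonneg_right hr' (abs_nonneg x)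
        simpa [abs_smul_real] using this
      smul_left' := by
        rintro r _ ⟨j, U, hU, hUs, rfl⟩
        obtain ⟨n, hnr⟩ := exists_nat_ge |r|
        have ht : Tendsto (fun e : E => n • e) (@nhds E τ 0) (@nhds E τ 0) := by
          have := (continuous_const_smul (T := E) n).tendsto 0
          rwa [smul_zero] at this
        obtain ⟨V, hV, hVs, hVU⟩ := hτ.exists_solid _ (ht hU)
        refine ⟨_, ⟨j, V, hV, hVs, rfl⟩, fun x hx => ?_⟩
        refine hUs (hVU hx) (abs_le_abs_of_nonneg' (hnn _ _) ((hmono j _ _ ?_).trans (hn j x n)))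
        rw [← Nat.cast_smul_eq_nsmul ℝ, abs_smul_real, abs_smul_real]
        refine smul_le_smul_of_nonneg_right ?_ (abs_nonneg x)
        rwa [Nat.abs_cast]
      -- Only here is the bound `|r| • e` needed: it makes `r ↦ r • x` continuous at `0`.
      smul_right' := by
        rintro x _ ⟨j, U, hU, hUs, rfl⟩
        obtain ⟨e, he⟩ := hsmul j x
        have ht : Tendsto (fun r : ℝ => |r| • e) (𝓝 0) (@nhds E τ 0) := by
          have := (continuous_abs.tendsto (0 : ℝ)).smul_const e
          rwa [abs_zero, zero_smul] at this
        filter_upwards [ht hU] with r hr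
        exact hUs hr (abs_le_abs_of_nonneg' (hnn _ _) (he r)) }
  have hbasis := B.toAddGroupFilterBasis.nhds_zero_hasBasis
  refine ⟨B.topology, ⟨B.toAddGroupFilterBasis.isTopologicalAddGroup, B.continuousSMul, ?_⟩, ?_⟩
  · intro U hU
    obtain ⟨s, hs, hsU⟩ := hbasis.mem_iff.1 hU
    refine ⟨s, hbasis.mem_of_mem hs, ?_, hsU⟩
    obtain ⟨j, U, hU, hUs, rfl⟩ := hs
    exact fun x hx y hy => hsol hUs hx (hmono j _ _ hy)
  · refine le_antisymm (le_iInf fun j => ?_) ?_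
    · refine tendsto_iff_comap.1 fun U hU => ?_
      obtain ⟨V, hV, hVs, hVU⟩ := hτ.exists_solid U hU
      exact mem_of_superset (hbasis.mem_of_mem ⟨j, V, hV, hVs, rfl⟩) fun a ha => hVU ha
    · refine hbasis.ge_iff.2 ?_
      rintro _ ⟨j, U, hU, hUs, rfl⟩
      exact mem_iInf_of_mem j (preimage_mem_comap hU)

theorem abs_add_inf_le (a b s : X) (hs : 0 ≤ s) : |a + b| ⊓ s ≤ |a| ⊓ s + |b| ⊓ s :=
  (inf_le_inf_right s (abs_add_le a b)).trans (add_inf_le (abs_nonneg a) (abs_nonneg b) hs)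

/-- A separating, directed family of positive order continuous operators into a space with a
Hausdorff uo-Lebesgue topology induces a Hausdorff uo-Lebesgue topology. -/
theorem IsHausdorffUOLebesgue.exists_of_family (hτ : IsHausdorffUOLebesgue τ) {ι : Type*}
    [Nonempty ι] (φ : ι → X →ₗ[ℝ] E) (hpos : ∀ i x, 0 ≤ x → 0 ≤ φ i x)
    (hdir : ∀ i j, ∃ k, (∀ x, 0 ≤ x → φ i x ≤ φ k x) ∧ ∀ x, 0 ≤ x → φ j x ≤ φ k x)
    (hcont : ∀ i (B : Type u) [Preorder B] [IsDirectedOrder B] [Nonempty B] (y : B → X),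
      Antitone y → IsGLB (range y) 0 → IsGLB (range fun b => φ i (y b)) 0)
    (hsep : ∀ x, 0 ≤ x → (∀ i, φ i x = 0) → x = 0) :
    ∃ σ : TopologicalSpace X, IsHausdorffUOLebesgue σ ∧
      ∀ {α : Type v} (l : Filter α) (f : α → X), Tendsto f l (@nhds X σ 0) ↔
        ∀ i s, 0 ≤ s → Tendsto (fun a => φ i (|f a| ⊓ s)) l (@nhds E τ 0) := by
  have hm : ∀ i x y, x ≤ y → φ i x ≤ φ i y := fun i x y h => by
    rw [← sub_nonneg, ← map_sub]; exact hpos i _ (sub_nonneg.2 h)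
  obtain ⟨σ, hσ, hn⟩ := hτ.toIsLocallySolid.exists_of_pseudonorms
    -- Truncation at `s` turns uo-null nets into order null ones, which the order continuous `φ i`
    -- carry to null nets.
    (J := ι × {s : X // 0 ≤ s}) (fun j x => φ j.1 (|x| ⊓ j.2))
    (fun j => by simp [j.2.2])
    (fun j a b h => hm _ _ _ (inf_le_inf_right _ h))
    (fun j a b => by
      rw [← map_add]
      exact hm _ _ _ (abs_add_inf_le a b _ j.2.2))
    (fun j x => ⟨φ j.1 |x|, fun r => by
      rw [← map_smul, ← abs_smul_real]
      exact hm _ _ _ inf_le_left⟩)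
    (fun j k => by
      obtain ⟨i, h1, h2⟩ := hdir j.1 k.1
      refine ⟨⟨i, j.2.1 + k.2.1, add_nonneg j.2.2 k.2.2⟩, fun x => ?_, fun x => ?_⟩
      · exact (h1 _ (le_inf (abs_nonneg _) j.2.2)).trans
          (hm _ _ _ (inf_le_inf_left _ (le_add_of_nonneg_right k.2.2)))
      · exact (h2 _ (le_inf (abs_nonneg _) k.2.2)).trans
          (hm _ _ _ (inf_le_inf_left _ (le_add_of_nonneg_left j.2.2))))
  refine ⟨σ, ⟨⟨hσ, ?_⟩, ?_⟩, ?_⟩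
  · intro A _ _ _ x hx
    rw [hn]
    refine tendsto_iInf.2 fun j => tendsto_comap_iff.2 ?_
    obtain ⟨B, _, _, _, y, hy, hy0, hB⟩ := hx _ j.2.2
    have ht := hτ.tendsto_of_antitone (y := fun b => φ j.1 (y b)) (fun a b h => hm _ _ _ (hy h))
      (hcont j.1 B y hy hy0)
    intro U hU
    obtain ⟨V, hV, hVs, hVU⟩ := hτ.exists_solid U hU
    obtain ⟨b, hb⟩ := (ht.eventually hV).exists
    obtain ⟨a₀, ha₀⟩ := hB b
    refine mem_map.2 (mem_of_superset (Ici_mem_atTop a₀) fun a ha => hVU (hVs hb ?_))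
    have h0 : 0 ≤ |x a| ⊓ (j.2 : X) := le_inf (abs_nonneg _) j.2.2
    have h1 : |x a| ⊓ (j.2 : X) ≤ y b := by
      have : |0 - |x a - 0| ⊓ (j.2 : X)| ≤ y b := ha₀ a ha
      rwa [zero_sub, abs_neg, sub_zero, abs_of_nonneg h0] at this
    exact abs_le_abs_of_nonneg' (hpos _ _ h0) (hm _ _ _ h1)
  · have := hσ.isTopologicalAddGroup
    refine IsTopologicalAddGroup.t2Space_of_zero_sep fun x hx => ?_
    have : ∃ i, φ i |x| ≠ 0 := by
      by_contra hc
      push Not at hc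
      have h0 := hsep _ (abs_nonneg x) hc
      have h1 := le_abs_self x
      have h2 := neg_le_abs x
      rw [h0] at h1 h2
      exact hx (le_antisymm h1 (neg_nonpos.1 h2))
    obtain ⟨i, hi⟩ := this
    obtain ⟨V, hV⟩ := NormalSeq.exists_notMem hτ hi
    -- Truncating at `|x|` itself leaves `|x|` intact, so this neighbourhood excludes `x`.
    refine ⟨(fun y => φ i (|y| ⊓ |x|)) ⁻¹' V.toSet 0, ?_, by simpa using hV⟩
    rw [hn]
    exact mem_iInf_of_mem (i, ⟨|x|, abs_nonneg x⟩) (preimage_mem_comap (V.mem_nhds 0))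
  · intro α l f
    rw [hn]
    simp only [tendsto_iInf, tendsto_comap_iff, Prod.forall, Subtype.forall]
    rfl

/-- A Hausdorff uo-Lebesgue topology on a Dedekind complete space is unbounded. -/
theorem IsHausdorffUOLebesgue.tendsto_of_abs_inf (hE : DedekindComplete E)
    (hτ : IsHausdorffUOLebesgue τ) {α : Type v} {l : Filter α} {f : α → E}
    (h : ∀ s, 0 ≤ s → Tendsto (fun a => |f a| ⊓ s) l (@nhds E τ 0)) :
    Tendsto f l (@nhds E τ 0) := by
  -- For the identity, the constructed topology is the unbounded version of `τ`; uniqueness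
  -- identifies it with `τ`.
  obtain ⟨σ, hσ, hn⟩ := hτ.exists_of_family (X := E) (ι := Unit) (fun _ => LinearMap.id)
    (fun _ _ h => h) (fun _ _ => ⟨(), by simp⟩) (fun _ _ _ _ _ _ _ h => h)
    (fun _ _ h => h ())
  rw [hτ.unique hE hσ]
  exact (hn l f).2 fun _ => h

end Existence

end VL

/-! ### Dedekind completeness and topologies of operator spaces -/

namespace VL

/-- An additive, positively homogeneous function on the positive cone extends linearly. -/
theorem exists_linearMap_of_cone {E : Type u} {F : Type v} [AddCommGroup E] [Lattice E]
    [IsOrderedAddMonoid E] [Module ℝ E] [IsOrderedModule ℝ E] [AddCommGroup F] [Module ℝ F]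
    (f : E → F) (hadd : ∀ x y, 0 ≤ x → 0 ≤ y → f (x + y) = f x + f y)
    (hsmul : ∀ (r : ℝ) x, 0 ≤ r → 0 ≤ x → f (r • x) = r • f x) :
    ∃ T : E →ₗ[ℝ] F, ∀ x, 0 ≤ x → T x = f x := by
  have h0 : f 0 = 0 := by simpa using hsmul 0 0 le_rfl le_rfl
  have key : ∀ {a b c d : E}, 0 ≤ a → 0 ≤ b → 0 ≤ c → 0 ≤ d → a - b = c - d →
      f a - f b = f c - f d := by
    intro a b c d ha hb hc hd h
    rw [sub_eq_sub_iff_add_eq_add] at h ⊢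
    rw [← hadd a d ha hd, ← hadd c b hc hb, h]
  refine ⟨{ toFun := fun x => f x⁺ - f x⁻, map_add' := fun x y => ?_, map_smul' := fun r x => ?_ },
    fun x hx => ?_⟩
  · rw [← add_sub_add_comm, ← hadd _ _ (posPart_nonneg x) (posPart_nonneg y),
      ← hadd _ _ (negPart_nonneg x) (negPart_nonneg y)]
    refine key (posPart_nonneg _) (negPart_nonneg _)
      (add_nonneg (posPart_nonneg x) (posPart_nonneg y))
      (add_nonneg (negPart_nonneg x) (negPart_nonneg y)) ?_
    rw [posPart_sub_negPart, add_sub_add_comm, posPart_sub_negPart, posPart_sub_negPart]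
  · rw [RingHom.id_apply]
    rcases le_total 0 r with hr | hr
    · rw [smul_sub, ← hsmul r _ hr (posPart_nonneg x), ← hsmul r _ hr (negPart_nonneg x)]
      refine key (posPart_nonneg _) (negPart_nonneg _) (smul_nonneg hr (posPart_nonneg x))
        (smul_nonneg hr (negPart_nonneg x)) ?_
      rw [posPart_sub_negPart, ← smul_sub, posPart_sub_negPart]
    · have hr' : 0 ≤ -r := neg_nonneg.2 hr
      have e : r • (f x⁺ - f x⁻) = -r • f x⁻ - -r • f x⁺ := by
        rw [← smul_sub, neg_smul, ← smul_neg, neg_sub]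
      rw [e, ← hsmul _ _ hr' (posPart_nonneg x), ← hsmul _ _ hr' (negPart_nonneg x)]
      refine key (posPart_nonneg _) (negPart_nonneg _) (smul_nonneg hr' (negPart_nonneg x))
        (smul_nonneg hr' (posPart_nonneg x)) ?_
      rw [posPart_sub_negPart, ← smul_sub, neg_smul, ← smul_neg, neg_sub, posPart_sub_negPart]
  · change f x⁺ - f x⁻ = f x
    rw [posPart_of_nonneg hx, negPart_of_nonneg hx, h0, sub_zero]

/-- Dedekind completeness follows from the existence of infima of nonnegative decreasing nets. -/
theorem DedekindComplete.of_antitone {X : Type u} [AddCommGroup X] [Lattice X]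
    [IsOrderedAddMonoid X]
    (h : ∀ (B : Type u) [Preorder B] [IsDirectedOrder B] [Nonempty B] (y : B → X), Antitone y →
      (∀ b, 0 ≤ y b) → ∃ g, IsGLB (range y) g) : DedekindComplete X := by
  classical
  rintro s ⟨x₀, hx₀⟩ ⟨M, hM⟩
  -- Suprema of finite subsets, subtracted from the bound `M`, give a nonnegative decreasing net.
  let B := {F : Finset X // F.Nonempty ∧ ∀ x ∈ F, x ∈ s}
  have : Nonempty B := ⟨⟨{x₀}, by simp, by simpa using hx₀⟩⟩
  have : IsDirectedOrder B := ⟨fun F G => ⟨⟨F.1 ∪ G.1, F.2.1.mono Finset.subset_union_left,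
    fun x hx => (Finset.mem_union.1 hx).elim (F.2.2 x) (G.2.2 x)⟩,
    Finset.subset_union_left, Finset.subset_union_right⟩⟩
  obtain ⟨g, hg⟩ := h B (fun F => M - F.1.sup' F.2.1 id)
    (fun F G hFG => sub_le_sub_left (Finset.sup'_mono id hFG F.2.1) M)
    (fun F => sub_nonneg.2 (Finset.sup'_le _ _ fun x hx => hM (F.2.2 x hx)))
  refine ⟨M - g, fun x hx => ?_, fun b hb => ?_⟩
  · have := hg.1 ⟨⟨{x}, by simp, by simpa using hx⟩, rfl⟩
    simpa using le_sub_comm.1 this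
  · rw [sub_le_comm]
    refine hg.2 ?_
    rintro _ ⟨F, rfl⟩
    exact sub_le_sub_left (Finset.sup'_le _ _ fun x hx => hb (F.2.2 x hx)) M

section Operators

variable {E : Type u} [AddCommGroup E] [ConditionallyCompleteLattice E] [IsOrderedAddMonoid E]
  [Module ℝ E] [IsOrderedModule ℝ E]

theorem dedekindComplete_of_conditionallyComplete : DedekindComplete E :=
  fun _ hs hb => ⟨_, isLUB_csSup hs hb⟩

/-- Evaluation of an order bounded operator at a point. -/
def Lob.eval (x : E) : Lob E E →ₗ[ℝ] E where
  toFun T := T x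
  map_add' _ _ := rfl
  map_smul' _ _ := rfl

@[simp] theorem Lob.eval_apply (x : E) (T : Lob E E) : Lob.eval x T = T x := rfl

theorem Lob.apply_mono {T : Lob E E} (hT : 0 ≤ T) {x y : E} (h : x ≤ y) : T x ≤ T y := by
  rw [← sub_nonneg, ← map_sub]
  exact hT _ (sub_nonneg.2 h)

/-- A decreasing net of positive operators has a pointwise infimum. -/
theorem Lob.exists_isGLB_apply {B : Type u} [Preorder B] [IsDirectedOrder B] [Nonempty B]
    {y : B → Lob E E} (hy : Antitone y) (h0 : ∀ b, 0 ≤ y b) :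
    ∃ R : Lob E E, ∀ x, 0 ≤ x → IsGLB (range fun b => y b x) (R x) := by
  have hg : ∀ x : E, 0 ≤ x → IsGLB (range fun b => y b x) (⨅ b, y b x) := fun x hx =>
    isGLB_ciInf ⟨0, by rintro _ ⟨b, rfl⟩; exact h0 b x hx⟩
  have hadd : ∀ x z : E, 0 ≤ x → 0 ≤ z →
      (⨅ b, y b (x + z)) = (⨅ b, y b x) + ⨅ b, y b z := by
    intro x z hx hz
    refine le_antisymm ?_ ((hg _ (add_nonneg hx hz)).2 ?_)
    · rw [← sub_le_iff_le_add']
      refine (hg z hz).2 ?_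
      rintro _ ⟨b, rfl⟩
      rw [sub_le_comm]
      refine (hg x hx).2 ?_
      rintro _ ⟨c, rfl⟩
      -- Directedness merges the two independent infima into one index; this is what makes the
      -- pointwise infimum additive.
      obtain ⟨d, hbd, hcd⟩ := exists_ge_ge b c
      rw [sub_le_iff_le_add]
      refine ((hg _ (add_nonneg hx hz)).1 ⟨d, rfl⟩).trans ?_
      simp only [map_add]
      exact add_le_add (hy hcd x hx) (hy hbd z hz)
    · rintro _ ⟨b, rfl⟩
      simp only [map_add]
      exact add_le_add ((hg x hx).1 ⟨b, rfl⟩) ((hg z hz).1 ⟨b, rfl⟩)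
  have hsmul : ∀ (r : ℝ) (x : E), 0 ≤ r → 0 ≤ x → (⨅ b, y b (r • x)) = r • ⨅ b, y b x := by
    intro r x hr hx
    rcases hr.eq_or_lt with rfl | hr'
    · simp
    have key : ∀ (s : ℝ) (w : E), 0 < s → 0 ≤ w →
        s • (⨅ b, y b w) ≤ ⨅ b, y b (s • w) := by
      intro s w hs hw
      refine (hg _ (smul_nonneg hs.le hw)).2 ?_
      rintro _ ⟨b, rfl⟩
      simp only [map_smul]
      exact smul_le_smul_of_nonneg_left ((hg w hw).1 ⟨b, rfl⟩) hs.le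
    refine le_antisymm ?_ (key r x hr' hx)
    have := smul_le_smul_of_nonneg_left
      (key r⁻¹ (r • x) (inv_pos.2 hr') (smul_nonneg hr hx)) hr
    rwa [smul_smul, mul_inv_cancel₀ hr'.ne', one_smul, smul_smul, inv_mul_cancel₀ hr'.ne',
      one_smul] at this
  obtain ⟨T, hT⟩ := exists_linearMap_of_cone (fun x => ⨅ b, y b x) hadd hsmul
  have hpos : ∀ x, 0 ≤ x → 0 ≤ T x := fun x hx => by
    rw [hT x hx]
    exact (hg x hx).2 (by rintro _ ⟨b, rfl⟩; exact h0 b x hx)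
  have hmono : ∀ {x z}, x ≤ z → T x ≤ T z := fun {x z} h => by
    rw [← sub_nonneg, ← map_sub]; exact hpos _ (sub_nonneg.2 h)
  refine ⟨⟨T, fun a b => ⟨T a, T b, fun x hx => ⟨hmono hx.1, hmono hx.2⟩⟩⟩, fun x hx => ?_⟩
  change IsGLB _ (T x)
  rw [hT x hx]
  exact hg x hx

theorem Lob.isGLB_of_apply {B : Type u} {y : B → Lob E E} {R : Lob E E}
    (hR : ∀ x, 0 ≤ x → IsGLB (range fun b => y b x) (R x)) : IsGLB (range y) R := by
  refine ⟨?_, fun S hS x hx => (hR x hx).2 ?_⟩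
  · rintro _ ⟨b, rfl⟩ x hx
    exact (hR x hx).1 ⟨b, rfl⟩
  · rintro _ ⟨b, rfl⟩
    exact hS ⟨b, rfl⟩ x hx

theorem Lob.dedekindComplete : DedekindComplete (Lob E E) :=
  .of_antitone fun _ _ _ _ _ hy h0 =>
    (Lob.exists_isGLB_apply hy h0).imp fun _ hR => Lob.isGLB_of_apply hR

/-- Evaluations are order continuous: the pointwise infimum is an operator and is also the infimum
in the operator order, hence it is `0`. -/
theorem Lob.isGLB_apply {B : Type u} [Preorder B] [IsDirectedOrder B] [Nonempty B]
    {y : B → Lob E E} (hy : Antitone y) (h : IsGLB (range y) 0) {x : E} (hx : 0 ≤ x) :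
    IsGLB (range fun b => y b x) 0 := by
  obtain ⟨R, hR⟩ := Lob.exists_isGLB_apply hy fun b => h.1 ⟨b, rfl⟩
  have : R = 0 := (Lob.isGLB_of_apply hR).unique h
  have h' := hR x hx
  rwa [this] at h'

theorem Lob.apply_abs_le {T : Lob E E} (hT : 0 ≤ T) (x : E) : |T x| ≤ T |x| := by
  refine abs_le'.2 ⟨Lob.apply_mono hT (le_abs_self x), ?_⟩
  rw [← map_neg]
  exact Lob.apply_mono hT (neg_le_abs x)

/-- Positive operators below an orthomorphism are orthomorphisms. -/
theorem Orth.mem_of_le {R T : Lob E E} (hR : 0 ≤ R) (hRT : R ≤ T) (hT : T ∈ Orth E) :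
    R ∈ Orth E := by
  intro B hB x hx
  have hx' : |x| ∈ B := hB.solid hx (by simp)
  refine hB.solid (hT B hB _ hx') ((Lob.apply_abs_le hR x).trans ?_)
  exact (hRT _ (abs_nonneg x)).trans (le_abs_self _)

theorem Orth.exists_isGLB_apply {B : Type u} [Preorder B] [IsDirectedOrder B] [Nonempty B]
    {y : B → Orth E} (hy : Antitone y) (h0 : ∀ b, 0 ≤ y b) :
    ∃ R : Orth E, IsGLB (range y) R ∧
      ∀ x, 0 ≤ x → IsGLB (range fun b => (y b : Lob E E) x) ((R : Lob E E) x) := by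
  obtain ⟨R, hR⟩ := Lob.exists_isGLB_apply (y := fun b => (y b : Lob E E)) hy h0
  have hg := Lob.isGLB_of_apply hR
  obtain ⟨b₀⟩ := ‹Nonempty B›
  have hR0 : 0 ≤ R := hg.2 (by rintro _ ⟨b, rfl⟩; exact h0 b)
  refine ⟨⟨R, Orth.mem_of_le hR0 (hg.1 ⟨b₀, rfl⟩) (y b₀).2⟩, ⟨?_, fun S hS => ?_⟩, hR⟩
  · rintro _ ⟨b, rfl⟩
    exact hg.1 ⟨b, rfl⟩
  · refine hg.2 ?_
    rintro _ ⟨b, rfl⟩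
    exact hS ⟨b, rfl⟩

theorem Orth.dedekindComplete : DedekindComplete (Orth E) :=
  .of_antitone fun _ _ _ _ _ hy h0 =>
    (Orth.exists_isGLB_apply hy h0).imp fun _ hR => hR.1

theorem Orth.isGLB_apply {B : Type u} [Preorder B] [IsDirectedOrder B] [Nonempty B]
    {y : B → Orth E} (hy : Antitone y) (h : IsGLB (range y) 0) {x : E} (hx : 0 ≤ x) :
    IsGLB (range fun b => (y b : Lob E E) x) 0 := by
  obtain ⟨R, hR, hRx⟩ := Orth.exists_isGLB_apply hy fun b => h.1 ⟨b, rfl⟩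
  have : R = 0 := hR.unique h
  have h' := hRx x hx
  rwa [this] at h'

variable {τ : TopologicalSpace E}

theorem Lob.exists_isHausdorffUOLebesgue (hτ : IsHausdorffUOLebesgue τ) :
    ∃ σ : TopologicalSpace (Lob E E), IsHausdorffUOLebesgue σ ∧
      ∀ {α : Type v} (l : Filter α) (T : α → Lob E E), Tendsto T l (@nhds (Lob E E) σ 0) ↔
        ∀ x : {x : E // 0 ≤ x}, ∀ S, 0 ≤ S →
          Tendsto (fun a => (|T a| ⊓ S) x) l (@nhds E τ 0) :=
  hτ.exists_of_family (ι := {x : E // 0 ≤ x}) (fun x => Lob.eval (x : E))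
    (fun x _ hT => hT x x.2)
    (fun x z => ⟨⟨x + z, add_nonneg x.2 z.2⟩,
      fun _ hT => Lob.apply_mono hT (le_add_of_nonneg_right z.2),
      fun _ hT => Lob.apply_mono hT (le_add_of_nonneg_left x.2)⟩)
    (fun x _ _ _ _ _ hy h => Lob.isGLB_apply hy h x.2)
    (fun _ _ h => Lob.ext_pos fun x hx => h ⟨x, hx⟩)

theorem Orth.exists_isHausdorffUOLebesgue (hτ : IsHausdorffUOLebesgue τ) :
    ∃ σ : TopologicalSpace (Orth E), IsHausdorffUOLebesgue σ ∧
      ∀ {α : Type v} (l : Filter α) (T : α → Orth E), Tendsto T l (@nhds (Orth E) σ 0) ↔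
        ∀ x : {x : E // 0 ≤ x}, ∀ S : Orth E, 0 ≤ S →
          Tendsto (fun a => ((|T a| ⊓ S : Orth E) : Lob E E) x) l (@nhds E τ 0) :=
  hτ.exists_of_family (ι := {x : E // 0 ≤ x})
    (fun x => (Lob.eval (x : E)).comp (Orth E).subtype)
    (fun x _ hT => hT x x.2)
    (fun x z => ⟨⟨x + z, add_nonneg x.2 z.2⟩,
      fun _ hT => Lob.apply_mono hT (le_add_of_nonneg_right z.2),
      fun _ hT => Lob.apply_mono hT (le_add_of_nonneg_left x.2)⟩)
    (fun x _ _ _ _ _ hy h => Orth.isGLB_apply hy h x.2)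
    (fun _ _ h => Subtype.ext (Lob.ext_pos fun x hx => h ⟨x, hx⟩))

end Operators

end VL

/-! ### Pointwise lattice operations on orthomorphisms -/

namespace VL

section Orthomorphisms

variable {E : Type u} [AddCommGroup E] [ConditionallyCompleteLattice E] [IsOrderedAddMonoid E]
  [Module ℝ E] [IsOrderedModule ℝ E]

/-- Band preservation, applied to the disjoint complement of `v`. -/
theorem Orth.inf_apply_eq_zero {T : Lob E E} (hT : T ∈ Orth E) {x v : E} (hv : 0 ≤ v)
    (h : |x| ⊓ v = 0) : |T x| ⊓ v = 0 :=
  hT _ (isBand_disjointComplement v hv) x h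

theorem Orth.apply_inf_apply_eq_zero {T : Lob E E} (hT : T ∈ Orth E) {x y : E}
    (h : |x| ⊓ |y| = 0) : |T x| ⊓ |T y| = 0 := by
  have h1 := Orth.inf_apply_eq_zero hT (abs_nonneg y) h
  rw [inf_comm] at h1 ⊢
  exact Orth.inf_apply_eq_zero hT (abs_nonneg _) h1

theorem Lob.le_pos (T : Lob E E) : T ≤ Lob.pos T := (Lob.isLUB_pos T).1 (mem_insert _ _)

theorem Lob.pos_nonneg (T : Lob E E) : 0 ≤ Lob.pos T :=
  (Lob.isLUB_pos T).1 (mem_insert_of_mem _ rfl)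

/-- Slicing `y` into layers of height `u`. -/
theorem sum_layers (y u : E) (hy : 0 ≤ y) (hu : 0 ≤ u) (n : ℕ) :
    ∑ i ∈ Finset.range n, (y - i • u)⁺ ⊓ u = y ⊓ n • u := by
  induction n with
  | zero => simp [hy]
  | succ n ih =>
    rw [Finset.sum_range_succ, ih, add_inf, inf_add_posPart_sub, succ_nsmul, inf_add,
      ← inf_assoc, inf_eq_left.2 (le_add_of_nonneg_right hu)]

/-- Where layer `i` is not full, `y` is below `(i + 1) • u`, and there no later layer is present. -/
theorem layers_disjoint (y u : E) (hu : 0 ≤ u) {i j : ℕ} (hij : i < j) :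
    |u - (y - i • u)⁺ ⊓ u| ⊓ |(y - j • u)⁺ ⊓ u| = 0 := by
  have hj0 : 0 ≤ (y - j • u)⁺ ⊓ u := le_inf (posPart_nonneg _) hu
  have hi0 : 0 ≤ u - (y - i • u)⁺ ⊓ u := sub_nonneg.2 inf_le_right
  rw [abs_of_nonneg hi0, abs_of_nonneg hj0]
  refine inf_eq_zero_mono hi0 hj0 ?_ ?_ (posPart_sub_inf_posPart_sub ((i + 1) • u) y)
  · rw [inf_comm, inf_eq_sub_posPart_sub, sub_sub_cancel]
    refine posPart_mono ?_
    calc u - (y - i • u)⁺ ≤ u - (y - i • u) := sub_le_sub_left (le_posPart _) u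
      _ = (i + 1) • u - y := by rw [succ_nsmul]; abel
  · refine inf_le_left.trans (posPart_mono (sub_le_sub_left ?_ y))
    exact nsmul_le_nsmul_left hu hij

/-- Cut `y` into `n` layers `w i` of height `u = x / n`. The excesses of `R (w i)` over `c = (R x)⁺
/ n` are pairwise disjoint and each at most `R⁺ x / n`, so their sum is too. Hence `R y ≤ (R x)⁺ +
R⁺ x / n` for every `n > 0`, and the Archimedean property applies. -/
theorem Orth.apply_le_posPart {R : Lob E E} (hR : R ∈ Orth E) {x y : E} (hy : 0 ≤ y)
    (hyx : y ≤ x) : R y ≤ (R x)⁺ := by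
  have hx : 0 ≤ x := hy.trans hyx
  refine (dedekindComplete_of_conditionallyComplete (E := E)).le_of_forall_smul_le
    (h := Lob.pos R x) fun n hn => ?_
  have hn' : (0 : ℝ) < n := by exact_mod_cast hn
  have hinv : (0 : ℝ) ≤ (n : ℝ)⁻¹ := (inv_pos.2 hn').le
  have hcancel : ∀ z : E, n • (n : ℝ)⁻¹ • z = z := fun z => by
    rw [← Nat.cast_smul_eq_nsmul ℝ, smul_smul, mul_inv_cancel₀ hn'.ne', one_smul]
  set u := (n : ℝ)⁻¹ • x with hu
  have hu0 : 0 ≤ u := smul_nonneg hinv hx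
  set c := (n : ℝ)⁻¹ • (R x)⁺ with hc
  have hc0 : 0 ≤ c := smul_nonneg hinv (posPart_nonneg _)
  have hRu : R u ≤ c := by
    rw [hu, map_smul]
    exact smul_le_smul_of_nonneg_left (le_posPart _) hinv
  let w : ℕ → E := fun i => (y - i • u)⁺ ⊓ u
  have hw0 : ∀ i, 0 ≤ w i := fun i => le_inf (posPart_nonneg _) hu0
  have hsum : y = ∑ i ∈ Finset.range n, w i := by
    rw [sum_layers y u hy hu0, hcancel, inf_eq_left.2 hyx]
  let e : ℕ → E := fun i => (R (w i) - c)⁺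
  -- Together with `he2`, this places `e i` and `e j`, for `i < j`, under the images of the disjoint
  -- elements `u - w i` and `w j`.
  have he1 : ∀ i, e i ≤ |R (u - w i)| := fun i => by
    refine sup_le ?_ (abs_nonneg _)
    rw [sub_le_iff_le_add]
    calc R (w i) = -R (u - w i) + R u := by rw [map_sub]; abel
      _ ≤ |R (u - w i)| + c := add_le_add (neg_le_abs _) hRu
  have he2 : ∀ i, e i ≤ (R (w i))⁺ := fun i => posPart_mono (sub_le_self _ hc0)
  have hsume : ∑ i ∈ Finset.range n, e i ≤ (n : ℝ)⁻¹ • Lob.pos R x := by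
    refine sum_le_of_pairwise_inf_eq_zero ?_ (fun i _ => posPart_nonneg _) (fun i _ => ?_) ?_
    · exact smul_nonneg hinv (Lob.pos_nonneg R x hx)
    · refine (he2 i).trans ?_
      rw [← map_smul]
      refine sup_le ((Lob.isLUB_pos_apply R hu0).1 ⟨w i, ⟨hw0 i, inf_le_right⟩, rfl⟩) ?_
      exact Lob.pos_nonneg R u hu0
    · intro i j hij _
      exact inf_eq_zero_mono (posPart_nonneg _) (posPart_nonneg _) (he1 i)
        ((he2 j).trans (posPart_le_abs _))
        (Orth.apply_inf_apply_eq_zero hR (layers_disjoint y u hu0 hij))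
  calc R y = ∑ i ∈ Finset.range n, R (w i) := by rw [← map_sum, ← hsum]
    _ ≤ ∑ i ∈ Finset.range n, (c + e i) := Finset.sum_le_sum fun i _ => by
        rw [← sub_le_iff_le_add']; exact le_posPart _
    _ = (R x)⁺ + ∑ i ∈ Finset.range n, e i := by
        rw [Finset.sum_add_distrib, Finset.sum_const, Finset.card_range, hcancel]
    _ ≤ (R x)⁺ + (n : ℝ)⁻¹ • Lob.pos R x := add_le_add_right hsume _

/-- The positive part of an orthomorphism is computed pointwise on the positive cone. -/
theorem Orth.pos_apply {R : Lob E E} (hR : R ∈ Orth E) {x : E} (hx : 0 ≤ x) :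
    Lob.pos R x = (R x)⁺ := by
  refine le_antisymm ((Lob.isLUB_pos_apply R hx).2 ?_) (sup_le ?_ ?_)
  · rintro _ ⟨y, hy, rfl⟩
    exact Orth.apply_le_posPart hR hy.1 hy.2
  · exact Lob.le_pos R x hx
  · exact Lob.pos_nonneg R x hx

theorem Orth.inf_apply {S T : Lob E E} (hS : S ∈ Orth E) (hT : T ∈ Orth E) {x : E}
    (hx : 0 ≤ x) : (S ⊓ T) x = S x ⊓ T x := by
  rw [Lob.inf_def, Lob.sub_apply, Orth.pos_apply ((Orth E).sub_mem hS hT) hx, Lob.sub_apply,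
    ← inf_eq_sub_posPart_sub]

theorem Orth.abs_apply {T : Lob E E} (hT : T ∈ Orth E) {x : E} (hx : 0 ≤ x) :
    |T| x = |T x| := by
  rw [abs, Lob.sup_def, Lob.add_apply,
    Orth.pos_apply ((Orth E).sub_mem hT ((Orth E).neg_mem hT)) hx, Lob.sub_apply, Lob.neg_apply,
    add_comm, ← sup_eq_add_posPart_sub]
  rfl

/-- `T x⁺` and `T x⁻` are disjoint, so their sum and their difference have the same modulus. -/
theorem Orth.abs_apply_abs {T : Lob E E} (hT : T ∈ Orth E) (x : E) : |T (|x|)| = |T x| := by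
  have hd : |T x⁺| ⊓ |T x⁻| = 0 := Orth.apply_inf_apply_eq_zero hT (by
    rw [abs_of_nonneg (posPart_nonneg x), abs_of_nonneg (negPart_nonneg x)]
    exact posPart_inf_negPart_eq_zero x)
  have key : ∀ a b : E, |a| ⊓ |b| = 0 → |a| ⊔ |b| ≤ |a - b| := by
    intro a b h
    have h1 : |a| ≤ |a - b| := by
      refine le_of_le_add_of_inf_eq_zero (abs_nonneg a) (abs_nonneg _) (abs_nonneg b) ?_ h
      simpa using abs_add_le (a - b) b
    have h2 : |b| ≤ |a - b| := by
      rw [inf_comm] at h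
      refine le_of_le_add_of_inf_eq_zero (abs_nonneg b) (abs_nonneg _) (abs_nonneg a) ?_ h
      rw [abs_sub_comm]
      simpa using abs_add_le (b - a) a
    exact sup_le h1 h2
  have e1 : |T (|x|)| = |T x⁺| + |T x⁻| := by
    rw [← posPart_add_negPart x, map_add]
    refine le_antisymm (abs_add_le _ _) ?_
    rw [add_eq_sup_of_inf_eq_zero hd]
    simpa using key (T x⁺) (-T x⁻) (by simpa using hd)
  have e2 : |T x| = |T x⁺| + |T x⁻| := by
    conv_lhs => rw [← posPart_sub_negPart x, map_sub]
    refine le_antisymm (abs_sub_le_add_abs _ _) ?_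
    rw [add_eq_sup_of_inf_eq_zero hd]
    exact key _ _ hd
  rw [e1, e2]

theorem Orth.abs_apply_mono {T : Lob E E} (hT : T ∈ Orth E) {x y : E} (h : |x| ≤ |y|) :
    |T x| ≤ |T y| := by
  rw [← Orth.abs_apply_abs hT x, ← Orth.abs_apply_abs hT y,
    ← Orth.abs_apply hT (abs_nonneg x), ← Orth.abs_apply hT (abs_nonneg y)]
  exact Lob.apply_mono (abs_nonneg T) h

end Orthomorphisms

end VL

/-! ### Convergence of nets of orthomorphisms -/

namespace VL

section Convergence

variable {E : Type u} [AddCommGroup E] [ConditionallyCompleteLattice E] [IsOrderedAddMonoid E]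
  [Module ℝ E] [IsOrderedModule ℝ E] {τ : TopologicalSpace E} {α : Type v} {l : Filter α}
  {T : α → Orth E}

/-- For nonnegative `x`, an orthomorphism sends `(x - g)⁺` into the band it generates, so that
`|T x| ⊓ y` is controlled by `|T g|` and the component of `y` in that band. -/
theorem Orth.abs_apply_inf_le {R : Lob E E} (hR : R ∈ Orth E) {x g y p : E} (hx : 0 ≤ x)
    (hg : 0 ≤ g) (hy : 0 ≤ y) (hp : IsLUB (range fun n : ℕ => y ⊓ n • (x - g)⁺) p) :
    |R x| ⊓ y ≤ |R g| + p := by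
  have h1 : |R x| ≤ |R g| + |R (x - g)⁺| := by
    have : R x = R (x ⊓ g) + R (x - g)⁺ := by rw [← map_add, inf_add_posPart_sub]
    rw [this]
    refine (abs_add_le _ _).trans (add_le_add_left (Orth.abs_apply_mono hR ?_) _)
    exact abs_le_abs_of_nonneg' (le_inf hx hg) inf_le_right
  have h2 : |R (x - g)⁺| ⊓ y ≤ p := by
    refine le_of_isLUB_inf_nsmul (posPart_nonneg _) (le_inf (abs_nonneg _) hy) hp inf_le_right
      fun v hv hbv => ?_
    refine inf_eq_zero_mono (le_inf (abs_nonneg _) hy) hv inf_le_left le_rfl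
      (Orth.inf_apply_eq_zero hR hv ?_)
    rwa [abs_of_nonneg (posPart_nonneg _)]
  calc |R x| ⊓ y ≤ (|R g| + |R (x - g)⁺|) ⊓ y := inf_le_inf_right _ h1
    _ ≤ |R g| ⊓ y + |R (x - g)⁺| ⊓ y := add_inf_le (abs_nonneg _) (abs_nonneg _) hy
    _ ≤ |R g| + p := add_le_add inf_le_left h2

theorem IsHausdorffUOLebesgue.tendsto_orth_apply_of_bandSpan (hτ : IsHausdorffUOLebesgue τ)
    {S : Set E} (hS : bandSpan S = ⊤)
    (h : ∀ s ∈ S, Tendsto (fun a => (T a : Lob E E) s) l (@nhds E τ 0)) (x : E) :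
    Tendsto (fun a => (T a : Lob E E) x) l (@nhds E τ 0) := by
  have hls := hτ.toIsLocallySolid
  have hE : DedekindComplete E := dedekindComplete_of_conditionallyComplete
  have habs : ∀ x : E, Tendsto (fun a => (T a : Lob E E) |x|) l (@nhds E τ 0) ↔
      Tendsto (fun a => (T a : Lob E E) x) l (@nhds E τ 0) := fun x => by
    rw [← hls.tendsto_abs_iff, ← hls.tendsto_abs_iff (f := fun a => (T a : Lob E E) x)]
    simp only [Orth.abs_apply_abs (T _).2]
  rw [← habs]
  have hx := abs_nonneg x
  set x' := |x| with hx'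
  clear_value x'
  refine hτ.tendsto_of_abs_inf hE fun y hy => ?_
  -- This cone is directed and contains every `|s|` with `s ∈ S`; it indexes the approximation of
  -- `x'`.
  let G := {g : E // 0 ≤ g ∧ Tendsto (fun a => (T a : Lob E E) g) l (@nhds E τ 0)}
  have hGadd : ∀ f g : G, 0 ≤ (f + g : E) ∧
      Tendsto (fun a => (T a : Lob E E) (f + g : E)) l (@nhds E τ 0) := fun f g =>
    ⟨add_nonneg f.2.1 g.2.1, by simpa only [map_add] using hls.tendsto_add f.2.2 g.2.2⟩
  have hG0 : (0 : E) ≤ 0 ∧ Tendsto (fun a => (T a : Lob E E) (0 : E)) l (@nhds E τ 0) :=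
    ⟨le_rfl, by simpa only [map_zero] using tendsto_const_nhds⟩
  have : Nonempty G := ⟨⟨0, hG0⟩⟩
  have : IsDirectedOrder G := ⟨fun f g => ⟨⟨f + g, hGadd f g⟩,
    le_add_of_nonneg_right g.2.1, le_add_of_nonneg_left f.2.1⟩⟩
  have hGn : ∀ (g : G) (n : ℕ), ∃ f : G, (f : E) = n • (g : E) := fun g n => by
    induction n with
    | zero => exact ⟨⟨0, hG0⟩, by simp⟩
    | succ n ih =>
      obtain ⟨f, hf⟩ := ih
      exact ⟨⟨f + g, hGadd f g⟩, by simp [hf, succ_nsmul]⟩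
  choose p hp using fun g : G => hE.exists_isLUB_inf_nsmul y (x' - g)⁺
  have hp0 : ∀ g, 0 ≤ p g := fun g => by simpa [hy] using (hp g).1 ⟨0, rfl⟩
  have hanti : Antitone p := fun f g hfg => (hp g).2 <| by
    rintro _ ⟨n, rfl⟩
    refine le_trans (inf_le_inf_left _ (nsmul_le_nsmul_right (posPart_mono ?_) n))
      ((hp f).1 ⟨n, rfl⟩)
    exact sub_le_sub_left (show (f : E) ≤ g from hfg) x'
  have hdis : ∀ g : G, p g ⊓ (g - x')⁺ = 0 := fun g => by
    refine inf_eq_zero_of_isLUB (posPart_nonneg _) (hp g) (hp0 g) ?_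
    rintro _ ⟨n, rfl⟩
    have hn := nsmul_nonneg (posPart_nonneg (x' - g)) n
    rw [posPart_of_nonneg (le_inf hy hn)]
    exact inf_eq_zero_mono (le_inf hy hn) (posPart_nonneg _) inf_le_right le_rfl
      (nsmul_inf_eq_zero (posPart_nonneg _) (posPart_nonneg _) (posPart_sub_inf_posPart_sub _ _) n)
  -- A common lower bound `q` has `q⁺` disjoint from every `(g - x')⁺`. With `g = n • |s|` this
  -- forces `n • (|s| ⊓ q⁺) ≤ x'` for all `n`, so `q⁺` is disjoint from `S` and vanishes.
  have hglb : IsGLB (range p) 0 := by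
    refine ⟨by rintro _ ⟨g, rfl⟩; exact hp0 g, fun q hq => ?_⟩
    have hqp : ∀ g, q⁺ ≤ p g := fun g => sup_le (hq ⟨g, rfl⟩) (hp0 g)
    have hq0 := posPart_nonneg q
    rw [← posPart_eq_zero]
    refine eq_zero_of_bandSpan_eq_top hS hq0 fun s hs => ?_
    have he0 : 0 ≤ |s| ⊓ q⁺ := le_inf (abs_nonneg s) hq0
    refine le_antisymm (hE.nonpos_of_nsmul_le (b := x') fun n => ?_) he0
    obtain ⟨f, hf⟩ := hGn ⟨|s|, abs_nonneg s, (habs s).2 (h s hs)⟩ n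
    refine le_of_le_add_of_inf_eq_zero (nsmul_nonneg he0 n) hx (posPart_nonneg (f - x')) ?_ ?_
    · calc n • (|s| ⊓ q⁺) ≤ n • |s| := nsmul_le_nsmul_right inf_le_left n
        _ = x' + (f - x') := by rw [hf]; abel
        _ ≤ x' + (f - x')⁺ := add_le_add_right (le_posPart _) _
    · exact nsmul_inf_eq_zero he0 (posPart_nonneg _) (inf_eq_zero_mono he0 (posPart_nonneg _)
        (inf_le_right.trans (hqp f)) le_rfl (hdis f)) n
  intro U hU
  obtain ⟨W, hW, hWs, hWU⟩ := hls.exists_solid U hU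
  obtain ⟨V, hV, hVs, -, hVa⟩ := hls.exists_solid_add hW
  obtain ⟨g, hg⟩ := ((hτ.tendsto_of_antitone hanti hglb).eventually hV).exists
  refine (g.2.2.eventually hV).mono fun a ha => hWU (hWs
    (hVa (|(T a : Lob E E) g|) (hVs ha (by simp)) _ hg) ?_)
  exact abs_le_abs_of_nonneg' (le_inf (abs_nonneg _) hy)
      (Orth.abs_apply_inf_le (T a).2 hx g.2.1 hy (hp g))

/-- The identity operator as an orthomorphism. -/
def Orth.id : Orth E :=
  ⟨⟨LinearMap.id, fun a b => ⟨a, b, fun _ hx => hx⟩⟩, fun _ _ _ hx => hx⟩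

theorem IsHausdorffUOLebesgue.tendsto_orth_apply (hτ : IsHausdorffUOLebesgue τ)
    (h : ∀ x : {x : E // 0 ≤ x}, ∀ S : Orth E, 0 ≤ S →
      Tendsto (fun a => ((|T a| ⊓ S : Orth E) : Lob E E) x) l (@nhds E τ 0)) (x : E) :
    Tendsto (fun a => (T a : Lob E E) x) l (@nhds E τ 0) := by
  have hls := hτ.toIsLocallySolid
  have hE : DedekindComplete E := dedekindComplete_of_conditionallyComplete
  refine hls.tendsto_abs_iff.1 ?_
  simp only [← Orth.abs_apply_abs (T _).2 x]
  refine hls.tendsto_abs_iff.2 (hτ.tendsto_of_abs_inf hE fun y hy => ?_)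
  have hx := abs_nonneg x
  set x' := |x| with hx'
  clear_value x'
  have hk : ∀ k : ℕ, Tendsto (fun a => |(T a : Lob E E) x'| ⊓ k • x') l (@nhds E τ 0) := by
    intro k
    have hid : (0 : Orth E) ≤ Orth.id := fun z hz => hz
    -- Multiples of the identity suffice as truncating operators, since at `x'` they truncate by `k
    -- • x'`.
    refine (h ⟨x', hx⟩ (k • Orth.id) (nsmul_nonneg hid k)).congr fun a => ?_
    have h1 : ((|T a| ⊓ k • Orth.id : Orth E) : Lob E E) x' =
        ((|T a| : Orth E) : Lob E E) x' ⊓ ((k • Orth.id : Orth E) : Lob E E) x' :=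
      Orth.inf_apply (|T a| : Orth E).2 (k • Orth.id : Orth E).2 hx
    have h2 : ((|T a| : Orth E) : Lob E E) x' = |(T a : Lob E E) x'| :=
      Orth.abs_apply (T a).2 hx
    have h3 : ((k • Orth.id : Orth E) : Lob E E) x' = k • x' :=
      map_nsmul ((Lob.eval x').comp (Orth E).subtype) k Orth.id
    rw [h1, h2, h3]
  obtain ⟨p, hp⟩ := hE.exists_isLUB_inf_nsmul y x'
  have hmono : Monotone fun n : ℕ => y ⊓ n • x' := fun m n hmn =>
    inf_le_inf_left _ (nsmul_le_nsmul_left hx hmn)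
  intro U hU
  obtain ⟨W, hW, hWs, hWU⟩ := hls.exists_solid U hU
  obtain ⟨V, hV, hVs, -, hVa⟩ := hls.exists_solid_add hW
  -- `p` is the component of `y` in the band of `x'`; truncating at a large multiple of `x'` loses
  -- only a small part of it.
  obtain ⟨_, ⟨k, rfl⟩, hkV⟩ := hτ.exists_sub_mem hp (range_nonempty _)
    (directedOn_range.2 hmono.directed_le) hV
  refine ((hk k).eventually hV).mono fun a ha => hWU (hWs (hVa _ ha _ hkV) ?_)
  have hz0 : 0 ≤ |(T a : Lob E E) x'| ⊓ y := le_inf (abs_nonneg _) hy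
  refine abs_le_abs_of_nonneg' hz0 ?_
  -- `T a x'` stays in the band generated by `x'`, so its truncation at `y` is below `p`.
  have hzp : |(T a : Lob E E) x'| ⊓ y ≤ p := by
    refine le_of_isLUB_inf_nsmul hx hz0 hp inf_le_right fun v hv hxv => ?_
    refine inf_eq_zero_mono hz0 hv inf_le_left le_rfl (Orth.inf_apply_eq_zero (T a).2 hv ?_)
    rwa [abs_of_nonneg hx]
  have hq0 : 0 ≤ p - y ⊓ k • x' := sub_nonneg.2 (hp.1 ⟨k, rfl⟩)
  calc |(T a : Lob E E) x'| ⊓ y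
      = (|(T a : Lob E E) x'| ⊓ y) ⊓ (y ⊓ k • x' + (p - y ⊓ k • x')) := by
        rw [add_sub_cancel, inf_eq_left.2 hzp]
    _ ≤ (|(T a : Lob E E) x'| ⊓ y) ⊓ (y ⊓ k • x') +
        (|(T a : Lob E E) x'| ⊓ y) ⊓ (p - y ⊓ k • x') :=
      inf_add_le (le_inf hy (nsmul_nonneg hx k)) hq0 hz0
    _ ≤ |(T a : Lob E E) x'| ⊓ k • x' + (p - y ⊓ k • x') :=
      add_le_add (inf_le_inf inf_le_left inf_le_right) inf_le_right

theorem IsHausdorffUOLebesgue.tendsto_abs_inf_apply (hτ : IsHausdorffUOLebesgue τ)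
    (h : ∀ x : E, Tendsto (fun a => (T a : Lob E E) x) l (@nhds E τ 0)) {x : E} (hx : 0 ≤ x)
    {S : Lob E E} (hS : 0 ≤ S) :
    Tendsto (fun a => (|(T a : Lob E E)| ⊓ S) x) l (@nhds E τ 0) := by
  refine hτ.tendsto_of_nonneg_of_le (hτ.tendsto_abs_iff.2 (h x))
    (fun a => le_inf (abs_nonneg (T a : Lob E E)) hS x hx) fun a => ?_
  rw [← Orth.abs_apply (T a).2 hx]
  exact (inf_le_left : |(T a : Lob E E)| ⊓ S ≤ |(T a : Lob E E)|) x hx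

end Convergence

end VL

/-! ### The main theorem -/

theorem mainTheorem7 {E : Type u} [AddCommGroup E] [ConditionallyCompleteLattice E]
    [IsOrderedAddMonoid E] [Module ℝ E] [IsOrderedModule ℝ E]
    (τE : TopologicalSpace E) (hτE : IsHausdorffUOLebesgue τE) :
    (∀ τ : TopologicalSpace E, IsHausdorffUOLebesgue τ → τ = τE) ∧
    (∃! τ : TopologicalSpace (Orth E), IsHausdorffUOLebesgue τ) ∧
    (∃! τ : TopologicalSpace (Lob E E), IsHausdorffUOLebesgue τ) ∧
    ∀ (τOrth : TopologicalSpace (Orth E)) (τLob : TopologicalSpace (Lob E E)),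
      IsHausdorffUOLebesgue τOrth → IsHausdorffUOLebesgue τLob →
      ∀ (A : Type v) [Preorder A] [IsDirectedOrder A] [Nonempty A] (T : A → Orth E),
        (∀ S : Set E, S.Nonempty → bandSpan S = ⊤ →
          List.TFAE [
            Tendsto T atTop (@nhds (Orth E) τOrth 0),
            Tendsto (fun a => (T a : Lob E E)) atTop (@nhds (Lob E E) τLob 0),
            ∀ s ∈ S, Tendsto (fun a => (T a : Lob E E) s) atTop (@nhds E τE 0),
            ∀ x : E, Tendsto (fun a => (T a : Lob E E) x) atTop (@nhds E τE 0)]) ∧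
        (∀ e : E, IsWeakOrderUnit e →
          (Tendsto T atTop (@nhds (Orth E) τOrth 0) ↔
            Tendsto (fun a => (T a : Lob E E) e) atTop (@nhds E τE 0))) := by
  obtain ⟨σO, hσO, hnO⟩ := Orth.exists_isHausdorffUOLebesgue hτE
  obtain ⟨σL, hσL, hnL⟩ := Lob.exists_isHausdorffUOLebesgue hτE
  refine ⟨fun τ hτ => hτ.unique dedekindComplete_of_conditionallyComplete hτE,
    ⟨σO, hσO, fun τ hτ => hτ.unique Orth.dedekindComplete hσO⟩,
    ⟨σL, hσL, fun τ hτ => hτ.unique Lob.dedekindComplete hσL⟩, ?_⟩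
  intro τO τL hO hL A _ _ _ T
  -- Uniqueness replaces the given topologies by the constructed ones, whose null nets are described
  -- by `hnO` and `hnL`.
  obtain rfl := hO.unique Orth.dedekindComplete hσO
  obtain rfl := hL.unique Lob.dedekindComplete hσL
  have tfae : ∀ S : Set E, S.Nonempty → bandSpan S = ⊤ →
      List.TFAE [
        Tendsto T atTop (@nhds (Orth E) τO 0),
        Tendsto (fun a => (T a : Lob E E)) atTop (@nhds (Lob E E) τL 0),
        ∀ s ∈ S, Tendsto (fun a => (T a : Lob E E) s) atTop (@nhds E τE 0),
        ∀ x : E, Tendsto (fun a => (T a : Lob E E) x) atTop (@nhds E τE 0)] := by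
    intro S _ hS
    tfae_have 1 → 4 := fun h => hτE.tendsto_orth_apply ((hnO _ _).1 h)
    tfae_have 4 → 3 := fun h s _ => h s
    tfae_have 3 → 4 := fun h => hτE.tendsto_orth_apply_of_bandSpan hS h
    tfae_have 4 → 2 := fun h => (hnL _ _).2 fun x S hS => hτE.tendsto_abs_inf_apply h x.2 hS
    -- The lattice operations of `Orth E` are those of `Lob E E`, so (1) tests against fewer
    -- truncating operators than (2).
    tfae_have 2 → 1 := fun h => (hnO _ _).2 fun x S hS => (hnL _ _).1 h x S hS
    tfae_finish
  refine ⟨tfae, fun e he => ?_⟩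
  exact ((tfae {e} (singleton_nonempty e) he).out 0 2).trans (by simp)
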